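/- Let $(M,J,g)$ be a Hermitian manifold of real dimension $2n\ge 6$: $M$ is a smooth manifold, $J$ is an integrable almost complex structure (its Nijenhuis tensor vanishes), and $g$ is a Riemannian metric with $g(JX,JY)=g(X,Y)$. Let $\Omega$ be the fundamental $2$-form, defined by $g(X,Y)=\Omega(X,JY)$, i.e. $\Omega(X,Y)=g(JX,Y)$. Let $J$ act on $k$-forms by $(J\alpha)(X_1,\dots,X_k)=\alpha(JX_1,\dots,JX_k)$, and put $\square=\tfrac12\, i\,dJd$, which equals $\partial\bar\partial$ on forms of type $(p,p)$. Let $*$ be the Hodge star of $g$ for the orientation given by $\Omega^n/n!$. The Lee form is the $1$-form $\theta=J*d*\Omega=-Jd^*\Omega$. The structure is called SKT (strong KT) if $\square\Omega=0$ but $d\Omega\neq 0$, balanced if $\theta=0$, and Kähler if $d\Omega=0$. Then $(M,J,g)$ can be SKT only if $\theta$ is not identically zero. Equivalently, if $\theta=0$ and $\square\Omega=\partial\bar\partial\Omega=0$, then $d\Omega=0$, i.e. the metric is Kähler. -/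

import Mathlib

open scoped Manifold ContDiff Topology Bundle

noncomputable section

/-! ### Linear algebra on a single vector space -/

section LinearAlgebra

variable {V : Type*} [AddCommGroup V] [Module ℝ V] [TopologicalSpace V]

/-- The insertion of the vectors `v` into the first `k` slots of a `(k + l)`-form. -/
def insertFirst {k l m : ℕ} (h : k + l = m) (vol : V [⋀^Fin m]→L[ℝ] ℝ) (v : Fin k → V) :
    V [⋀^Fin l]→L[ℝ] ℝ where
  toFun w := vol (Sum.elim v w ∘ (finSumFinEquiv.trans (finCongr h)).symm)
  map_update_add' w i x y := by
    classical
    have key : ∀ z, Sum.elim v (Function.update w i z) ∘ (finSumFinEquiv.trans (finCongr h)).symm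
        = Function.update (Sum.elim v w ∘ (finSumFinEquiv.trans (finCongr h)).symm)
          (finSumFinEquiv.trans (finCongr h) (Sum.inr i)) z := by
      intro z
      rw [← Sum.update_elim_inr, Function.update_comp_equiv]
      simp
    have hw := vol.map_update_add (Sum.elim v w ∘ (finSumFinEquiv.trans (finCongr h)).symm)
      (finSumFinEquiv.trans (finCongr h) (Sum.inr i)) x y
    simp only [← key] at hw
    convert hw using 3
  map_update_smul' w i c x := by
    classical
    have key : ∀ z, Sum.elim v (Function.update w i z) ∘ (finSumFinEquiv.trans (finCongr h)).symm
        = Function.update (Sum.elim v w ∘ (finSumFinEquiv.trans (finCongr h)).symm)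
          (finSumFinEquiv.trans (finCongr h) (Sum.inr i)) z := by
      intro z
      rw [← Sum.update_elim_inr, Function.update_comp_equiv]
      simp
    have hw := vol.map_update_smul (Sum.elim v w ∘ (finSumFinEquiv.trans (finCongr h)).symm)
      (finSumFinEquiv.trans (finCongr h) (Sum.inr i)) c x
    simp only [← key] at hw
    convert hw using 3
  map_eq_zero_of_eq' w i j hw hij := by
    refine vol.map_eq_zero_of_eq _ (i := finSumFinEquiv.trans (finCongr h) (Sum.inr i))
      (j := finSumFinEquiv.trans (finCongr h) (Sum.inr j)) (by simpa using hw) ?_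
    intro hc
    exact hij (Sum.inr_injective ((finSumFinEquiv.trans (finCongr h)).injective hc))
  cont := by
    refine vol.cont.comp (continuous_pi fun a => ?_)
    simp only [Function.comp_apply]
    rcases (finSumFinEquiv.trans (finCongr h)).symm a with b | b
    · exact continuous_const
    · exact continuous_apply b

/-- The Hodge star `α ↦ *α` from `k`-forms to `l`-forms, `k + l = m = dim V`, of the inner product
`g` and the unit volume form `vol`, in index notation:
`(*α)(w₁, …, w_l) = (1 / k!) ∑ g^{p₁q₁} ⋯ g^{p_kq_k} α(b_{p₁}, …, b_{p_k})
  vol(b_{q₁}, …, b_{q_k}, w₁, …, w_l)`,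
where `g^{pq}` is the inverse of the Gram matrix `g(b_p, b_q)` of a basis `b` of `V`
(the value does not depend on `b`). This is the normalization `β ∧ *α = ⟨β, α⟩ vol`. -/
def hodgeStar {ι : Type*} [Fintype ι] [DecidableEq ι] {k l m : ℕ} (h : k + l = m)
    (g : V →L[ℝ] V →L[ℝ] ℝ) (vol : V [⋀^Fin m]→L[ℝ] ℝ) (b : Module.Basis ι ℝ V)
    (α : V [⋀^Fin k]→L[ℝ] ℝ) : V [⋀^Fin l]→L[ℝ] ℝ :=
  ((k.factorial : ℝ)⁻¹) • ∑ p : Fin k → ι, ∑ q : Fin k → ι,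
    ((∏ i, (Matrix.of fun r s => g (b r) (b s))⁻¹ (p i) (q i)) * α (b ∘ p)) •
      insertFirst h vol (b ∘ q)

/-- The multilinear map `(v₀, …, v_{2n-1}) ↦ Ω(v₀, v₁) Ω(v₂, v₃) ⋯ Ω(v_{2n-2}, v_{2n-1})`, with
the arguments indexed by pairs. -/
def tensorPower (n : ℕ) (Ω : V [⋀^Fin 2]→L[ℝ] ℝ) :
    ContinuousMultilinearMap ℝ (fun _ : Fin n × Fin 2 => V) ℝ where
  toFun v := ∏ i, Ω fun j => v (i, j)
  map_update_add' v a x y := by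
    classical
    obtain ⟨i, j⟩ := a
    have key : ∀ z, (∏ i', Ω fun j' => Function.update v (i, j) z (i', j')) =
        Ω (Function.update (fun j' => v (i, j')) j z) *
          ∏ i' ∈ Finset.univ.erase i, Ω fun j' => v (i', j') := by
      intro z
      rw [← Finset.mul_prod_erase _ _ (Finset.mem_univ i)]
      congr 1
      · congr 1
        ext j'
        by_cases hj : j' = j <;> simp [hj]
      · refine Finset.prod_congr rfl fun i' hi' => ?_
        have : i' ≠ i := Finset.ne_of_mem_erase hi'
        simp [this]
    have h1 := key (x + y)
    have h2 := key x
    have h3 := key y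
    rw [Ω.map_update_add, add_mul, ← h2, ← h3] at h1
    convert h1 using 4
  map_update_smul' v a c x := by
    classical
    obtain ⟨i, j⟩ := a
    have key : ∀ z, (∏ i', Ω fun j' => Function.update v (i, j) z (i', j')) =
        Ω (Function.update (fun j' => v (i, j')) j z) *
          ∏ i' ∈ Finset.univ.erase i, Ω fun j' => v (i', j') := by
      intro z
      rw [← Finset.mul_prod_erase _ _ (Finset.mem_univ i)]
      congr 1
      · congr 1
        ext j'
        by_cases hj : j' = j <;> simp [hj]
      · refine Finset.prod_congr rfl fun i' hi' => ?_
        have : i' ≠ i := Finset.ne_of_mem_erase hi'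
        simp [this]
    have h1 := key (c • x)
    have h2 := key x
    rw [Ω.map_update_smul, smul_mul_assoc, ← h2] at h1
    convert h1 using 4
  cont := by
    refine continuous_finsetProd _ fun i _ => Ω.cont.comp (continuous_pi fun j => ?_)
    exact continuous_apply (i, j)

/-- The `n`-th exterior power `Ωⁿ = Ω ∧ ⋯ ∧ Ω` of a `2`-form, that is
`2⁻ⁿ ∑_σ sign(σ) ∏_i Ω(v_{σ(2i)}, v_{σ(2i+1)})`. -/
def wedgePower (n : ℕ) (Ω : V [⋀^Fin 2]→L[ℝ] ℝ) : V [⋀^Fin (2 * n)]→L[ℝ] ℝ :=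
  ((2 : ℝ) ^ n)⁻¹ • (((tensorPower n Ω).domDomCongr
    (finProdFinEquiv.trans (finCongr (Nat.mul_comm n 2)))).alternatization)

end LinearAlgebra

/-! ### Differential forms on a manifold -/

section Forms

variable {E : Type*} [NormedAddCommGroup E] [NormedSpace ℝ E]
  {M : Type*} [TopologicalSpace M] [ChartedSpace E M]

variable (E M) in
/-- (Not necessarily smooth) real differential `k`-forms on `M`. -/
abbrev DiffForm (k : ℕ) : Type _ :=
  (x : M) → TangentSpace 𝓘(ℝ, E) x [⋀^Fin k]→L[ℝ] ℝ

/-- The expression of a differential form in the chart at `x₀`: its pullback under the inverse of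
the chart. -/
def inChart {k : ℕ} (α : DiffForm E M k) (x₀ : M) : E → E [⋀^Fin k]→L[ℝ] ℝ :=
  fun y => (α ((extChartAt 𝓘(ℝ, E) x₀).symm y)).compContinuousLinearMap
    (mfderiv 𝓘(ℝ, E) 𝓘(ℝ, E) (extChartAt 𝓘(ℝ, E) x₀).symm y)

/-- The exterior derivative of a differential form on a manifold, computed at `x` in the chart
at `x`. -/
def exteriorD {k : ℕ} (α : DiffForm E M k) : DiffForm E M (k + 1) :=
  fun x => (extDeriv (inChart α x) (extChartAt 𝓘(ℝ, E) x x)).compContinuousLinearMap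
    (mfderiv 𝓘(ℝ, E) 𝓘(ℝ, E) (extChartAt 𝓘(ℝ, E) x) x)

end Forms

/-! ### Hermitian manifolds -/

section Hermitian

variable (E : Type*) [NormedAddCommGroup E] [NormedSpace ℝ E]
  (M : Type*) [TopologicalSpace M] [ChartedSpace E M] [IsManifold 𝓘(ℝ, E) ∞ M]

/-- A Hermitian structure `(J, g)` on a smooth manifold `M`: an integrable almost complex structure
`J` (one with vanishing Nijenhuis tensor) and a Riemannian metric `g` for which `J` is
orthogonal. -/
structure HermitianStructure where
  /-- The complex structure. -/
  J : (x : M) → TangentSpace 𝓘(ℝ, E) x →L[ℝ] TangentSpace 𝓘(ℝ, E) x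
  contMDiff_J : ContMDiff 𝓘(ℝ, E) (𝓘(ℝ, E).prod 𝓘(ℝ, E →L[ℝ] E)) ∞
    (fun x => (Bundle.TotalSpace.mk' (E →L[ℝ] E) x (J x) :
      Bundle.TotalSpace (E →L[ℝ] E)
        (fun x : M => TangentSpace 𝓘(ℝ, E) x →L[ℝ] TangentSpace 𝓘(ℝ, E) x)))
  J_sq : ∀ x (v : TangentSpace 𝓘(ℝ, E) x), J x (J x v) = -v
  /-- The Nijenhuis tensor vanishes: `[JX, JY] - J[JX, Y] - J[X, JY] - [X, Y] = 0` for all smooth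
  vector fields `X`, `Y` on open subsets of `M`. -/
  nijenhuis_eq_zero : ∀ (U : Set M), IsOpen U →
    ∀ X Y : (x : M) → TangentSpace 𝓘(ℝ, E) x,
      ContMDiffOn 𝓘(ℝ, E) 𝓘(ℝ, E).tangent ∞ (fun x => (⟨x, X x⟩ : TangentBundle 𝓘(ℝ, E) M)) U →
      ContMDiffOn 𝓘(ℝ, E) 𝓘(ℝ, E).tangent ∞ (fun x => (⟨x, Y x⟩ : TangentBundle 𝓘(ℝ, E) M)) U →
      ∀ x ∈ U,
        VectorField.mlieBracket 𝓘(ℝ, E) (fun y => J y (X y)) (fun y => J y (Y y)) x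
          - J x (VectorField.mlieBracket 𝓘(ℝ, E) (fun y => J y (X y)) Y x)
          - J x (VectorField.mlieBracket 𝓘(ℝ, E) X (fun y => J y (Y y)) x)
          - VectorField.mlieBracket 𝓘(ℝ, E) X Y x = 0
  /-- The Riemannian metric. -/
  g : Bundle.ContMDiffRiemannianMetric 𝓘(ℝ, E) ∞ E (fun x : M => TangentSpace 𝓘(ℝ, E) x)
  g_J_J : ∀ x (v w : TangentSpace 𝓘(ℝ, E) x), g.inner x (J x v) (J x w) = g.inner x v w

namespace HermitianStructure

variable {E M}
variable (S : HermitianStructure E M)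

/-- The fundamental `2`-form `Ω(X, Y) = g(JX, Y)`. -/
def fundamentalForm : DiffForm E M 2 := fun x =>
  { toFun := fun v => S.g.inner x (S.J x (v 0)) (v 1)
    map_update_add' := by
      intro _ v i a b
      fin_cases i <;> simp
    map_update_smul' := by
      intro _ v i c a
      fin_cases i <;> simp
    map_eq_zero_of_eq' := by
      intro v i j hv hij
      have h01 : v 0 = v 1 := by
        fin_cases i <;> fin_cases j <;> simp_all
      have h := S.g_J_J x (S.J x (v 0)) (v 0)
      rw [S.J_sq, S.g.symm x (S.J x (v 0)) (v 0)] at h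
      rw [← h01, S.g.symm x (S.J x (v 0)) (v 0)]
      simp only [map_neg, FunLike.coe_neg, Pi.neg_apply] at h
      linarith
    cont := by
      let B : E →L[ℝ] E →L[ℝ] ℝ := S.g.inner x
      let A : E →L[ℝ] E := S.J x
      have h : Continuous fun v : Fin 2 → E => B (A (v 0)) (v 1) := by fun_prop
      exact h }

/-- `Ω` is normalized by `g(X, Y) = Ω(X, JY)`. -/
theorem fundamentalForm_J (x : M) (v w : TangentSpace 𝓘(ℝ, E) x) :
    S.fundamentalForm x ![v, S.J x w] = S.g.inner x v w :=
  S.g_J_J x v w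

/-- The action of `J` on forms, `(Jα)(X₁, …, X_k) = α(JX₁, …, JX_k)`; it is multiplication by
`i^{p-q}` on forms of type `(p, q)`. -/
def actJ {k : ℕ} (α : DiffForm E M k) : DiffForm E M k :=
  fun x => (α x).compContinuousLinearMap (S.J x)

/-- The operator `□ = ½ i dJd` on real forms; its values are complex-valued forms. It equals `∂∂̄`
on forms of type `(p, p)`. -/
def box {k : ℕ} (α : DiffForm E M k) :
    (x : M) → TangentSpace 𝓘(ℝ, E) x [⋀^Fin (k + 1 + 1)]→L[ℝ] ℂ :=
  fun x => (Complex.I / 2) •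
    Complex.ofRealCLM.compContinuousAlternatingMap (exteriorD (S.actJ (exteriorD α)) x)

/-- The Hermitian structure is strong KT (SKT): `□Ω = 0` but `dΩ ≠ 0`. -/
def IsSKT : Prop := S.box S.fundamentalForm = 0 ∧ exteriorD S.fundamentalForm ≠ 0

/-- The Hermitian structure is Kähler: `dΩ = 0`. -/
def IsKahler : Prop := exteriorD S.fundamentalForm = 0

/-- The Riemannian volume form `Ωⁿ / n!` of a Hermitian structure in real dimension `2n`, for the
orientation defined by `J`. -/
def volumeForm (n : ℕ) : DiffForm E M (2 * n) :=
  fun x => ((n.factorial : ℝ)⁻¹) • wedgePower n (S.fundamentalForm x)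

/-- The Hodge star operator from `k`-forms to `l`-forms, `k + l = 2n`, in real dimension `2n`. -/
def hodge [FiniteDimensional ℝ E] {k l n : ℕ} (h : k + l = 2 * n) (α : DiffForm E M k) :
    DiffForm E M l :=
  fun x => hodgeStar (V := TangentSpace 𝓘(ℝ, E) x) h (S.g.inner x) (S.volumeForm n x)
    (Module.finBasis ℝ E) (α x)

/-- The Lee form `θ = J * d * Ω` in real dimension `2n`, `n ≥ 1`. -/
def leeForm [FiniteDimensional ℝ E] {n : ℕ} (hn : 1 ≤ n) : DiffForm E M 1 :=
  S.actJ (S.hodge (k := 2 * n - 2 + 1) (l := 1) (n := n) (by omega)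
    (exteriorD (S.hodge (k := 2) (l := 2 * n - 2) (n := n) (by omega) S.fundamentalForm)))

/-- The Hermitian structure is balanced: `θ = 0`. -/
def IsBalanced [FiniteDimensional ℝ E] {n : ℕ} (hn : 1 ≤ n) : Prop := S.leeForm hn = 0

end HermitianStructure

end Hermitian

end

/-! The argument is local and pointwise: one scalar contraction of `d(J dΩ)` turns out to be a
nonzero multiple of `|dΩ|²` once the metric is balanced. No integration is involved.

Let `K` be the bivector inverse to `Ω`. Raising both indices of `Ω` with `g` gives `-K`, so `*Ω` is
`-½` times the contraction of `Ωⁿ/n!` with `K`, and no longer mentions `g`. Hence `d*Ω` is the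
contraction of the volume form with the vector `D` obtained as a divergence of `K`
(`extDeriv_contract_bivector`). Lowering the index of `D` with `Ω`, and using the logarithmic
derivative of `Ωⁿ`, gives a nonzero multiple of the `K`-trace of `dΩ` (`exists_extDeriv_star`). The
star is injective on contractions of the volume form with vectors, so `θ = 0` makes `dΩ` trace-free.
Since `J` preserves `Ω`, the twist `S = J dΩ` is trace-free as well, on a whole neighbourhood.

Now let `dS = 0` and fix a point with an orthonormal basis `b`. Contracting `dS` twice with `K`
gives `4X`, where `X = ∑ K(i,j) ∂_{J b_c} S(b_c, b_i, b_j)`, so `X = 0`. Differentiating the trace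
condition moves the derivative from `S` to `K = Ω⁻¹`, and `∂K = -K (∂Ω) K` turns `X` into `-∑ S(b_c,
b_i, b_j) (∂_{J b_c} Ω)(J b_i, J b_j)`. The components of `S` are the alternating sum of the second
factor, so this is `-|S|²/3`. Thus `S = 0`, and so `dΩ = 0` (`extDeriv_eq_zero_of_twist_closed`). -/

noncomputable section

/-! ### Top powers of 2-forms: naturality and nonvanishing. -/

section WedgePower

variable {V : Type*} [AddCommGroup V] [Module ℝ V] [TopologicalSpace V]

theorem wedgePower_apply (n : ℕ) (Ω : V [⋀^Fin 2]→L[ℝ] ℝ) (v : Fin (2 * n) → V) :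
    wedgePower n Ω v = ((2 : ℝ) ^ n)⁻¹ * ∑ σ : Equiv.Perm (Fin (2 * n)),
      ((Equiv.Perm.sign σ : ℤ) : ℝ) * ∏ i : Fin n, Ω fun j =>
        v (σ ((finProdFinEquiv.trans (finCongr (Nat.mul_comm n 2))) (i, j))) := by
  simp only [wedgePower, ContinuousAlternatingMap.smul_apply,
    ContinuousMultilinearMap.alternatization_apply_apply, smul_eq_mul, Units.smul_def, zsmul_eq_mul]
  rfl

/-- Naturality of `Ωⁿ` serves twice: to carry the volume form into a chart, and to differentiate
`Ωⁿ` along a family of pullbacks. -/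
theorem wedgePower_compContinuousLinearMap {V' : Type*} [AddCommGroup V'] [Module ℝ V']
    [TopologicalSpace V'] (n : ℕ) (Ω : V [⋀^Fin 2]→L[ℝ] ℝ) (A : V' →L[ℝ] V) :
    wedgePower n (Ω.compContinuousLinearMap A) =
      (wedgePower n Ω).compContinuousLinearMap A := by
  ext v
  simp only [ContinuousAlternatingMap.compContinuousLinearMap_apply, wedgePower_apply]
  rfl

/-- A permutation of `α × β` that maps fibres of the first projection into fibres has the sign of
the product of its restrictions to the fibres, if `β` has two elements. -/
theorem sign_eq_prod_sign_of_fst_eq {n : ℕ} (τ : Equiv.Perm (Fin n × Fin 2))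
    (h : ∀ i, (τ (i, 0)).1 = (τ (i, 1)).1) :
    ∃ (κ : Equiv.Perm (Fin n)) (ρ : Fin n → Equiv.Perm (Fin 2)),
      (∀ i j, τ (i, j) = (κ i, ρ i j)) ∧
      Equiv.Perm.sign τ = ∏ i, Equiv.Perm.sign (ρ i) := by
  have h' : ∀ i j, (τ (i, j)).1 = (τ (i, 0)).1 := by
    intro i j
    fin_cases j
    · rfl
    · exact (h i).symm
  have hsurj : Function.Surjective fun i => (τ (i, 0)).1 := by
    intro k
    obtain ⟨⟨i, j⟩, hij⟩ := τ.surjective (k, 0)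
    refine ⟨i, ?_⟩
    simp only
    rw [← h' i j, hij]
  let κ : Equiv.Perm (Fin n) := Equiv.ofBijective _ (Finite.surjective_iff_bijective.1 hsurj)
  have hinj : ∀ i, Function.Injective fun j => (τ (i, j)).2 := by
    intro i j j' hj
    have : τ (i, j) = τ (i, j') := Prod.ext ((h' i j).trans (h' i j').symm) hj
    simpa using τ.injective this
  let ρ : Fin n → Equiv.Perm (Fin 2) := fun i =>
    Equiv.ofBijective _ (Finite.injective_iff_bijective.1 (hinj i))
  have hτ : ∀ i j, τ (i, j) = (κ i, ρ i j) := fun i j => Prod.ext (h' i j) rfl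
  refine ⟨κ, ρ, hτ, ?_⟩
  -- The base permutation `κ` acts on both columns of `Fin n × Fin 2`, so its sign enters squared
  -- and disappears.
  have hcomp : τ = (Equiv.prodCongrLeft (fun _ : Fin 2 => κ) : Equiv.Perm (Fin n × Fin 2)) *
      Equiv.prodCongrRight ρ := by
    ext1 ⟨i, j⟩
    rw [hτ]
    rfl
  rw [hcomp, map_mul, Equiv.Perm.sign_prodCongrLeft, Equiv.Perm.sign_prodCongrRight]
  simp

/-- A `2`-form with a symplectic basis has a nonzero top power. -/
theorem wedgePower_ne_zero {n : ℕ} (Ω : V [⋀^Fin 2]→L[ℝ] ℝ) (e : Fin n × Fin 2 → V)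
    (h01 : ∀ i, Ω ![e (i, 0), e (i, 1)] = 1)
    (hne : ∀ a c, a.1 ≠ c.1 → Ω ![e a, e c] = 0) : wedgePower n Ω ≠ 0 := by
  set ε := finProdFinEquiv.trans (finCongr (Nat.mul_comm n 2))
  intro h0
  have hz : wedgePower n Ω (e ∘ ε.symm) = 0 := by rw [h0]; rfl
  rw [wedgePower_apply] at hz
  have hΩ : ∀ v : Fin 2 → V, Ω v = Ω ![v 0, v 1] := by
    intro v
    congr 1
    ext j
    fin_cases j <;> rfl
  have hperm : ∀ (i : Fin n) (ρ : Equiv.Perm (Fin 2)),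
      Ω (fun j => e (i, ρ j)) = ((Equiv.Perm.sign ρ : ℤ) : ℝ) := by
    intro i ρ
    have h1 : Ω (fun j => e (i, ρ j)) = Equiv.Perm.sign ρ • Ω (fun j => e (i, j)) :=
      Ω.toAlternatingMap.map_perm (fun j => e (i, j)) ρ
    rw [h1, hΩ, h01, Units.smul_def, zsmul_eq_mul, mul_one]
  -- No term is negative. A permutation preserving the pairs contributes the square of its sign, any
  -- other contributes `0`, and the identity contributes `1`.
  have hpos : 0 < ∑ σ : Equiv.Perm (Fin (2 * n)),
      ((Equiv.Perm.sign σ : ℤ) : ℝ) * ∏ i : Fin n, Ω fun j => (e ∘ ε.symm) (σ (ε (i, j))) := by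
    refine Finset.sum_pos' ?_ ⟨1, Finset.mem_univ _, ?_⟩
    · intro σ _
      let τ : Equiv.Perm (Fin n × Fin 2) := (ε.trans σ).trans ε.symm
      by_cases hτ : ∀ i, (τ (i, 0)).1 = (τ (i, 1)).1
      · obtain ⟨κ, ρ, h1, h2⟩ := sign_eq_prod_sign_of_fst_eq τ hτ
        have hs : Equiv.Perm.sign σ = Equiv.Perm.sign τ :=
          (Equiv.Perm.sign_symm_trans_trans σ ε.symm).symm
        have hp : ∀ i, (Ω fun j => (e ∘ ε.symm) (σ (ε (i, j)))) =
            ((Equiv.Perm.sign (ρ i) : ℤ) : ℝ) := by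
          intro i
          rw [← hperm (κ i) (ρ i)]
          congr 1
          ext j
          rw [← h1]
          rfl
        simp only [hp]
        rw [hs, h2, Units.coe_prod, Int.cast_prod]
        exact mul_self_nonneg _
      · push Not at hτ
        obtain ⟨i, hi⟩ := hτ
        rw [Finset.prod_eq_zero (Finset.mem_univ i), mul_zero]
        rw [hΩ]
        exact hne (τ (i, 0)) (τ (i, 1)) hi
    · have : ∀ i, (Ω fun j => (e ∘ ε.symm) ((1 : Equiv.Perm (Fin (2 * n))) (ε (i, j)))) = 1 := by
        intro i
        rw [hΩ]
        simp [h01]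
      rw [Finset.prod_congr rfl fun i _ => this i]
      simp
  rw [mul_eq_zero] at hz
  rcases hz with hz | hz
  · simp at hz
  · exact hpos.ne' hz

end WedgePower

/-! ### Forms of top degree. -/

section TopForms

variable {E : Type*} [NormedAddCommGroup E] [NormedSpace ℝ E]

/-- Transport of an alternating form along an equality of degrees. -/
def castForm {m m' : ℕ} (h : m = m') (φ : E [⋀^Fin m]→L[ℝ] ℝ) : E [⋀^Fin m']→L[ℝ] ℝ := h ▸ φ

theorem castForm_apply {m m' : ℕ} (h : m = m') (φ : E [⋀^Fin m]→L[ℝ] ℝ) (v : Fin m' → E) :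
    castForm h φ v = φ (v ∘ Fin.cast h) := by
  subst h
  rfl

/-- Rewrites the slots as iterated `Fin.cons`, the shape in which `topForm_contract` and currying
apply; the cast absorbs `2 + l` versus `l + 1 + 1`. -/
theorem insertFirst_two_apply {l m : ℕ} (h : 2 + l = m) (φ : E [⋀^Fin m]→L[ℝ] ℝ) (u v : E)
    (w : Fin l → E) :
    insertFirst h φ ![u, v] w =
      castForm (show m = l + 1 + 1 by omega) φ (Fin.cons u (Fin.cons v w : Fin (l + 1) → E)) := by
  subst h
  rw [castForm_apply]
  change φ _ = φ _
  congr 1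
  funext i
  refine Fin.addCases (fun j => ?_) (fun j => ?_) i
  · have : (finSumFinEquiv.trans (finCongr rfl)).symm (Fin.castAdd l j) = Sum.inl j := by
      simp
    simp only [Function.comp_apply]
    rw [this]
    fin_cases j <;> rfl
  · have : (finSumFinEquiv.trans (finCongr rfl)).symm (Fin.natAdd 2 j) = Sum.inr j := by
      simp
    simp only [Function.comp_apply]
    rw [this]
    have : Fin.cast (show 2 + l = l + 1 + 1 by omega) (Fin.natAdd 2 j) = j.succ.succ := by
      ext
      simp
    rw [this]
    simp

/-- Moving the last slot to the front is a cyclic rotation. Its sign is left unevaluated, since only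
its being nonzero matters later. -/
theorem insertFirst_one_apply {k : ℕ} (φ : E [⋀^Fin (k + 1)]→L[ℝ] ℝ) (v : Fin k → E)
    (w : Fin 1 → E) :
    insertFirst (rfl : k + 1 = k + 1) φ v w =
      ((Equiv.Perm.sign (finRotate (k + 1)) : ℤ) : ℝ) * φ (Fin.cons (w 0) v) := by
  have h1 : insertFirst (rfl : k + 1 = k + 1) φ v w =
      φ ((Fin.cons (w 0) v : Fin (k + 1) → E) ∘ finRotate (k + 1)) := by
    change φ _ = φ _
    congr 1
    rw [show ((Fin.cons (w 0) v : Fin (k + 1) → E) ∘ finRotate (k + 1)) =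
      @Fin.snoc k (fun _ => E) v (w 0) from (Fin.snoc_eq_cons_rotate v (w 0)).symm]
    funext i
    refine Fin.addCases (fun j => ?_) (fun j => ?_) i
    · have : (finSumFinEquiv.trans (finCongr (rfl : k + 1 = k + 1))).symm (Fin.castAdd 1 j) =
        Sum.inl j := by simp
      simp only [Function.comp_apply]
      rw [this]
      exact (Fin.snoc_castSucc (α := fun _ => E) (w 0) v j).symm
    · have : (finSumFinEquiv.trans (finCongr (rfl : k + 1 = k + 1))).symm (Fin.natAdd k j) =
        Sum.inr j := by simp
      simp only [Function.comp_apply]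
      rw [this]
      obtain rfl : j = 0 := Subsingleton.elim _ _
      exact (Fin.snoc_last (α := fun _ => E) (w 0) v).symm
  have h2 : φ ((Fin.cons (w 0) v : Fin (k + 1) → E) ∘ finRotate (k + 1)) =
      Equiv.Perm.sign (finRotate (k + 1)) • φ (Fin.cons (w 0) v) :=
    φ.toAlternatingMap.map_perm _ _
  rw [h1, h2, Units.smul_def, zsmul_eq_mul]

variable [FiniteDimensional ℝ E]

/-- `λ ∧ φ = 0` for a top-degree form `φ`, contracted with a vector `u`. -/
theorem topForm_contract {k : ℕ} (hdim : Module.finrank ℝ E = k + 1)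
    (φ : E [⋀^Fin (k + 1)]→L[ℝ] ℝ) (μ : E →L[ℝ] ℝ) (u : E) (v : Fin (k + 1) → E) :
    μ u * φ v = ∑ i : Fin (k + 1), (-1) ^ (i : ℕ) * (μ (v i) * φ (Fin.cons u (i.removeNth v))) := by
  have h0 : (ContinuousAlternatingMap.alternatizeUncurryFin (μ.smulRight φ)) (Fin.cons u v) = 0 := by
    apply AlternatingMap.map_linearDependent
      (ContinuousAlternatingMap.alternatizeUncurryFin (μ.smulRight φ)).toAlternatingMap
    intro hli
    have := hli.fintype_card_le_finrank
    simp [hdim] at this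
  rw [ContinuousAlternatingMap.alternatizeUncurryFin_apply, Fin.sum_univ_succ] at h0
  simp only [Fin.val_zero, pow_zero, one_smul, ContinuousLinearMap.smulRight_apply, Fin.cons_zero,
    ContinuousAlternatingMap.smul_apply, smul_eq_mul, Fin.val_succ, Fin.cons_succ] at h0
  have h1 : (Fin.removeNth 0 (Fin.cons u v : Fin (k + 1 + 1) → E)) = v := rfl
  have h2 : ∀ i : Fin (k + 1), (Fin.removeNth i.succ (Fin.cons u v : Fin (k + 1 + 1) → E)) =
      Fin.cons u (i.removeNth v) := by
    intro i
    exact funext (Fin.cases rfl fun _ => by simp [Fin.removeNth])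
  rw [h1] at h0
  rw [eq_neg_of_add_eq_zero_left h0, ← Finset.sum_neg_distrib]
  refine Finset.sum_congr rfl fun i _ => ?_
  rw [h2, pow_succ]
  simp

/-- If `u ≠ 0`, take a functional `μ` with `μ u ≠ 0`: by `topForm_contract`, `μ u * φ v` is a
combination of values of `φ` with `u` in the first slot, which forces `φ = 0`. -/
theorem eq_zero_of_topForm_cons_eq_zero {k : ℕ} (hdim : Module.finrank ℝ E = k + 1)
    {φ : E [⋀^Fin (k + 1)]→L[ℝ] ℝ} (hφ : φ ≠ 0) {u : E} (h : ∀ w : Fin k → E, φ (Fin.cons u w) = 0) :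
    u = 0 := by
  by_contra hu
  obtain ⟨μ, hμ⟩ := SeparatingDual.exists_ne_zero (R := ℝ) hu
  refine hφ (ContinuousAlternatingMap.ext fun v => ?_)
  have := topForm_contract hdim φ μ u v
  simp only [h, mul_zero, Finset.sum_const_zero, mul_eq_zero, hμ, false_or] at this
  simpa using this

theorem topForm_comp {m : ℕ} (hdim : Module.finrank ℝ E = m) (φ : E [⋀^Fin m]→L[ℝ] ℝ)
    (A : E →ₗ[ℝ] E) (v : Fin m → E) : φ (A ∘ v) = LinearMap.det A * φ v := by
  let b := Module.finBasisOfFinrankEq ℝ E hdim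
  have h := φ.toAlternatingMap.eq_smul_basis_det b
  have h' : ∀ w, φ w = φ b * b.det w := fun w => congrArg (fun F => F w) h
  rw [h', h' v, b.det_comp]
  ring

end TopForms

/-! ### Unitary bases of a Hermitian vector space. -/

section HermitianBasis

variable {E : Type*} [NormedAddCommGroup E] [NormedSpace ℝ E]
  {g : E →L[ℝ] E →L[ℝ] ℝ} {J : E →L[ℝ] E}

theorem inner_J_self_eq_zero (hsymm : ∀ u v, g u v = g v u) (hJ : ∀ v, J (J v) = -v)
    (hgJ : ∀ u v, g (J u) (J v) = g u v) (u : E) : g (J u) u = 0 := by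
  have h := hgJ (J u) u
  rw [hJ, hsymm (J u) u, map_neg] at h
  simp only [FunLike.coe_neg, Pi.neg_apply] at h
  rw [hsymm]
  linarith

variable [FiniteDimensional ℝ E]

/-- Gram–Schmidt over the complex numbers: the next vector lies in the common kernel of the `2k`
functionals `g (e i)` and `g (J (e i))`, which is nonzero while `2k` is below the dimension. -/
theorem exists_unitary_family (hsymm : ∀ u v, g u v = g v u) (hpos : ∀ v, v ≠ 0 → 0 < g v v)
    (hJ : ∀ v, J (J v) = -v) (hgJ : ∀ u v, g (J u) (J v) = g u v) (k : ℕ)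
    (hk : 2 * k ≤ Module.finrank ℝ E) :
    ∃ e : Fin k → E, (∀ i j, g (e i) (e j) = if i = j then 1 else 0) ∧
      ∀ i j, g (J (e i)) (e j) = 0 := by
  induction k with
  | zero => exact ⟨Fin.elim0, fun i => i.elim0, fun i => i.elim0⟩
  | succ k ih =>
    obtain ⟨e, he1, he2⟩ := ih (by omega)
    let f : E →ₗ[ℝ] (Fin k → ℝ) × (Fin k → ℝ) :=
      LinearMap.prod (LinearMap.pi fun i => (g (e i) : E →ₗ[ℝ] ℝ))
        (LinearMap.pi fun i => (g (J (e i)) : E →ₗ[ℝ] ℝ))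
    have hker : f.ker ≠ ⊥ := by
      apply LinearMap.ker_ne_bot_of_finrank_lt
      simp
      omega
    obtain ⟨u, hu, hu0⟩ := Submodule.exists_mem_ne_zero_of_ne_bot hker
    rw [LinearMap.mem_ker, Prod.ext_iff] at hu
    have h1 : ∀ i, g (e i) u = 0 := fun i => congrFun hu.1 i
    have h2 : ∀ i, g (J (e i)) u = 0 := fun i => congrFun hu.2 i
    have h3 : ∀ i, g (J u) (e i) = 0 := fun i => by
      have := h2 i
      rw [← hgJ, hJ, map_neg, FunLike.coe_neg, Pi.neg_apply, neg_eq_zero, hsymm] at this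
      exact this
    set c := (Real.sqrt (g u u))⁻¹
    have hc : c * (c * g u u) = 1 := by
      have h0 := hpos u hu0
      have := Real.mul_self_sqrt h0.le
      have h' : Real.sqrt (g u u) ≠ 0 := (Real.sqrt_pos.2 h0).ne'
      simp only [c]
      field_simp
      nlinarith
    refine ⟨Fin.cons (c • u) e, ?_, ?_⟩
    · intro i j
      refine Fin.cases ?_ (fun i => ?_) i <;> refine Fin.cases ?_ (fun j => ?_) j
      · simpa using hc
      · simp [hsymm u, h1, (Fin.succ_ne_zero j).symm]
      · simp [h1]
      · simp [he1]
    · intro i j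
      refine Fin.cases ?_ (fun i => ?_) i <;> refine Fin.cases ?_ (fun j => ?_) j
      · simp [inner_J_self_eq_zero hsymm hJ hgJ]
      · simp [h3]
      · simp [h2]
      · simp [he2]

theorem exists_unitary_basis {n : ℕ} (hn : 0 < n) (hdim : Module.finrank ℝ E = 2 * n)
    (hsymm : ∀ u v, g u v = g v u) (hpos : ∀ v, v ≠ 0 → 0 < g v v)
    (hJ : ∀ v, J (J v) = -v) (hgJ : ∀ u v, g (J u) (J v) = g u v) :
    ∃ b : Module.Basis (Fin n × Fin 2) ℝ E,
      (∀ a c, g (b a) (b c) = if a = c then 1 else 0) ∧ ∀ i, b (i, 1) = J (b (i, 0)) := by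
  obtain ⟨e, he1, he2⟩ := exists_unitary_family hsymm hpos hJ hgJ n hdim.ge
  let f : Fin n × Fin 2 → E := fun a => if a.2 = 0 then e a.1 else J (e a.1)
  have hf : ∀ a c, g (f a) (f c) = if a = c then 1 else 0 := by
    rintro ⟨i, j⟩ ⟨i', j'⟩
    fin_cases j <;> fin_cases j' <;> simp [f, he1, he2, hgJ, hsymm (e i)]
  have hli : LinearIndependent ℝ f := by
    rw [Fintype.linearIndependent_iff]
    intro c hc a
    have := congrArg (g (f a)) hc
    simpa [hf] using this
  have : Nonempty (Fin n × Fin 2) := ⟨(⟨0, hn⟩, 0)⟩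
  refine ⟨basisOfLinearIndependentOfCardEqFinrank hli (by simp [hdim, mul_comm]), ?_, ?_⟩
  · simpa using hf
  · intro i
    simp [f]

theorem wedgePower_fundamental_ne_zero {n : ℕ} (hn : 0 < n) (hdim : Module.finrank ℝ E = 2 * n)
    (hsymm : ∀ u v, g u v = g v u) (hpos : ∀ v, v ≠ 0 → 0 < g v v)
    (hJ : ∀ v, J (J v) = -v) (hgJ : ∀ u v, g (J u) (J v) = g u v)
    (Ω : E [⋀^Fin 2]→L[ℝ] ℝ) (hΩ : ∀ u v, Ω ![u, v] = g (J u) v) : wedgePower n Ω ≠ 0 := by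
  obtain ⟨b, hb, hbJ⟩ := exists_unitary_basis hn hdim hsymm hpos hJ hgJ
  apply wedgePower_ne_zero Ω b
  · intro i
    rw [hΩ, ← hbJ, hb, if_pos rfl]
  · rintro ⟨i, j⟩ ⟨i', j'⟩ hne
    have hne' : i ≠ i' := hne
    rw [hΩ]
    fin_cases j
    · change g (J (b (i, 0))) _ = 0
      rw [← hbJ, hb, if_neg]
      simp [hne']
    · change g (J (b (i, 1))) _ = 0
      rw [hbJ, hJ, map_neg, FunLike.coe_neg, Pi.neg_apply, hb, if_neg, neg_zero]
      simp [hne']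

end HermitianBasis

/-! ### Matrices of 2-forms and the trace against the inverse of a 2-form. -/

section FormMatrix

variable {V : Type*} [AddCommGroup V] [Module ℝ V] [TopologicalSpace V]

theorem twoForm_swap (Ω : V [⋀^Fin 2]→L[ℝ] ℝ) (u v : V) : Ω ![u, v] = -Ω ![v, u] := by
  have h := Ω.toAlternatingMap.map_swap ![v, u] (show (0 : Fin 2) ≠ 1 by simp)
  have h2 : (![v, u] ∘ Equiv.swap (0 : Fin 2) 1 : Fin 2 → V) = ![u, v] := by
    ext i
    fin_cases i <;> simp
  rw [h2] at h
  exact h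

/-- A `2`-form as a bilinear form. -/
def twoFormBilin (Ω : V [⋀^Fin 2]→L[ℝ] ℝ) : LinearMap.BilinForm ℝ V :=
  LinearMap.mk₂ ℝ (fun u v => Ω ![u, v])
    (fun u u' v => Ω.toAlternatingMap.map_vecCons_add ![v] u u')
    (fun c u v => Ω.toAlternatingMap.map_vecCons_smul ![v] c u)
    (fun u v v' => by
      have := Ω.toAlternatingMap.map_vecCons_add ![u] v v'
      change Ω ![v + v', u] = Ω ![v, u] + Ω ![v', u] at this
      rw [twoForm_swap Ω u, this, twoForm_swap Ω u v, twoForm_swap Ω u v']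
      ring)
    (fun c u v => by
      have := Ω.toAlternatingMap.map_vecCons_smul ![u] c v
      change Ω ![c • v, u] = c • Ω ![v, u] at this
      rw [twoForm_swap Ω u, this, twoForm_swap Ω u v, smul_neg])

@[simp]
theorem twoFormBilin_apply (Ω : V [⋀^Fin 2]→L[ℝ] ℝ) (u v : V) :
    twoFormBilin Ω u v = Ω ![u, v] := rfl

variable {ι : Type*} [Fintype ι] [DecidableEq ι]

/-- The matrix of a `2`-form in a basis. -/
def formMatrix (Ω : V [⋀^Fin 2]→L[ℝ] ℝ) (b : Module.Basis ι ℝ V) : Matrix ι ι ℝ :=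
  LinearMap.BilinForm.toMatrix b (twoFormBilin Ω)

theorem formMatrix_apply (Ω : V [⋀^Fin 2]→L[ℝ] ℝ) (b : Module.Basis ι ℝ V) (r s : ι) :
    formMatrix Ω b r s = Ω ![b r, b s] := by
  simp [formMatrix, LinearMap.BilinForm.toMatrix_apply]

theorem formMatrix_transpose (Ω : V [⋀^Fin 2]→L[ℝ] ℝ) (b : Module.Basis ι ℝ V) :
    (formMatrix Ω b).transpose = -formMatrix Ω b := by
  ext r s
  rw [Matrix.transpose_apply, Matrix.neg_apply, formMatrix_apply, formMatrix_apply, twoForm_swap]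

theorem formMatrix_inv_transpose (Ω : V [⋀^Fin 2]→L[ℝ] ℝ) (b : Module.Basis ι ℝ V) :
    (formMatrix Ω b)⁻¹.transpose = -(formMatrix Ω b)⁻¹ := by
  rw [Matrix.transpose_nonsing_inv, formMatrix_transpose]
  by_cases h : IsUnit (formMatrix Ω b).det
  · apply Matrix.inv_eq_left_inv
    rw [neg_mul_neg, Matrix.nonsing_inv_mul _ h]
  -- For a singular matrix both sides are `0`, the default value of the matrix inverse.
  · rw [Matrix.nonsing_inv_apply_not_isUnit _ h, neg_zero, Matrix.nonsing_inv_apply_not_isUnit]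
    rwa [← formMatrix_transpose, Matrix.det_transpose]

theorem formMatrix_inv_swap (Ω : V [⋀^Fin 2]→L[ℝ] ℝ) (b : Module.Basis ι ℝ V) (i j : ι) :
    (formMatrix Ω b)⁻¹ i j = -(formMatrix Ω b)⁻¹ j i := by
  have := congrFun (congrFun (formMatrix_inv_transpose Ω b) j) i
  rwa [Matrix.transpose_apply, Matrix.neg_apply] at this

/-- The contraction of a bilinear form with the inverse of a `2`-form. -/
def contractInv (Ω : V [⋀^Fin 2]→L[ℝ] ℝ) (b : Module.Basis ι ℝ V) (β : V → V → ℝ) : ℝ :=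
  ∑ i, ∑ j, (formMatrix Ω b)⁻¹ i j * β (b i) (b j)

theorem contractInv_eq_trace (Ω : V [⋀^Fin 2]→L[ℝ] ℝ) (b : Module.Basis ι ℝ V)
    (β : LinearMap.BilinForm ℝ V) :
    contractInv Ω b (fun u v => β u v) =
      ((formMatrix Ω b)⁻¹ * (LinearMap.BilinForm.toMatrix b β).transpose).trace := by
  simp [contractInv, Matrix.trace, Matrix.mul_apply, LinearMap.BilinForm.toMatrix_apply]

/-- Both matrices transform by `M ↦ Pᵀ M P`, so the product of the inverse of one with the transpose
of the other is conjugated by `P`, and its trace is unchanged. -/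
theorem contractInv_basis_independent (Ω : V [⋀^Fin 2]→L[ℝ] ℝ) (b c : Module.Basis ι ℝ V)
    (β : LinearMap.BilinForm ℝ V) :
    contractInv Ω b (fun u v => β u v) = contractInv Ω c (fun u v => β u v) := by
  rw [contractInv_eq_trace, contractInv_eq_trace, formMatrix, formMatrix,
    ← LinearMap.BilinForm.toMatrix_mul_basis_toMatrix b c (twoFormBilin Ω),
    ← LinearMap.BilinForm.toMatrix_mul_basis_toMatrix b c β]
  set P := b.toMatrix c
  have hP : P * c.toMatrix b = 1 := b.toMatrix_mul_toMatrix_flip c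
  have hP' : IsUnit P.det := Matrix.isUnit_det_of_right_inverse hP
  have hPt : IsUnit P.transpose.det := by rwa [Matrix.det_transpose]
  have h : ∀ M N : Matrix ι ι ℝ, (P.transpose * M * P)⁻¹ * (P.transpose * N * P).transpose =
      P⁻¹ * (M⁻¹ * N.transpose * P) := by
    intro M N
    simp only [Matrix.mul_inv_rev, Matrix.transpose_mul, Matrix.transpose_transpose]
    calc P⁻¹ * (M⁻¹ * P.transpose⁻¹) * (P.transpose * (N.transpose * P))
        = P⁻¹ * (M⁻¹ * ((P.transpose⁻¹ * P.transpose) * (N.transpose * P))) := by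
          simp only [Matrix.mul_assoc]
      _ = _ := by rw [Matrix.nonsing_inv_mul _ hPt, Matrix.one_mul, Matrix.mul_assoc]
  rw [h, Matrix.trace_mul_comm P⁻¹, Matrix.mul_assoc, Matrix.mul_assoc,
    Matrix.mul_nonsing_inv _ hP', Matrix.mul_one]

end FormMatrix

/-! ### The Hodge star of the fundamental form, and injectivity of the star in degree one below the
top. -/

section Hodge

variable {E : Type*} [NormedAddCommGroup E] [NormedSpace ℝ E]
  {g : E →L[ℝ] E →L[ℝ] ℝ} {ι : Type*} [Fintype ι] [DecidableEq ι]

theorem isUnit_det_gram (hpos : ∀ v, v ≠ 0 → 0 < g v v) (b : Module.Basis ι ℝ E) :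
    IsUnit (Matrix.of fun r s => g (b r) (b s)).det := by
  rw [isUnit_iff_ne_zero]
  intro h0
  obtain ⟨c, hc, hG⟩ := Matrix.exists_mulVec_eq_zero_iff.2 h0
  set u := ∑ s, c s • b s with hu
  have h1 : ∀ r, g (b r) u = 0 := by
    intro r
    have := congrFun hG r
    simp only [Matrix.mulVec, dotProduct, Matrix.of_apply, Pi.zero_apply] at this
    rw [hu, map_sum, ← this]
    exact Finset.sum_congr rfl fun s _ => by simp [mul_comm]
  have h2 : g u u = 0 := by
    have h2' : g u = ∑ s, c s • g (b s) := by simp [hu]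
    rw [h2']
    simp [h1]
  have h3 : u = 0 := by
    by_contra hne
    exact (hpos u hne).ne' h2
  exact hc (funext fun s => Fintype.linearIndependent_iff.1 b.linearIndependent c h3 s)

theorem gram_inv_symm (hsymm : ∀ u v, g u v = g v u) (b : Module.Basis ι ℝ E) :
    (Matrix.of fun r s => g (b r) (b s))⁻¹.transpose = (Matrix.of fun r s => g (b r) (b s))⁻¹ := by
  rw [Matrix.transpose_nonsing_inv]
  congr 1
  ext r s
  simp [hsymm (b s)]

/-- With `A` the matrix of `J` and `G` the Gram matrix, the matrix of `Ω` is `Aᵀ G`; the Gram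
factors cancel and `A² = -1` remains. So raising both indices of `Ω` gives minus its inverse. -/
theorem formMatrix_mul_gram_inv {J : E →L[ℝ] E}
    (hpos : ∀ v, v ≠ 0 → 0 < g v v) (hJ : ∀ v, J (J v) = -v)
    (Ω : E [⋀^Fin 2]→L[ℝ] ℝ) (hΩ : ∀ u v, Ω ![u, v] = g (J u) v) (b : Module.Basis ι ℝ E) :
    formMatrix Ω b * ((Matrix.of fun r s => g (b r) (b s))⁻¹ * formMatrix Ω b *
      (Matrix.of fun r s => g (b r) (b s))⁻¹) = -1 := by
  set G : Matrix ι ι ℝ := Matrix.of fun r s => g (b r) (b s)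
  have hG : IsUnit G.det := isUnit_det_gram hpos b
  set A := LinearMap.toMatrix b b (J : E →ₗ[ℝ] E)
  have hA : A * A = -1 := by
    rw [← LinearMap.toMatrix_comp]
    have : (J : E →ₗ[ℝ] E) ∘ₗ (J : E →ₗ[ℝ] E) = -LinearMap.id := by
      ext v
      simp [hJ]
    rw [this, map_neg, LinearMap.toMatrix_id]
  have hW : formMatrix Ω b = A.transpose * G := by
    ext r s
    rw [formMatrix_apply, hΩ, Matrix.mul_apply]
    have h1 : g (J (b r)) = ∑ j, b.repr (J (b r)) j • g (b j) := by
      calc g (J (b r)) = g (∑ j, b.repr (J (b r)) j • b j) := by rw [b.sum_repr]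
        _ = _ := by simp only [map_sum, map_smul]
    rw [h1]
    simp [A, G, LinearMap.toMatrix_apply]
  rw [hW]
  calc A.transpose * G * (G⁻¹ * (A.transpose * G) * G⁻¹)
      = A.transpose * (G * G⁻¹) * A.transpose * (G * G⁻¹) := by simp only [Matrix.mul_assoc]
    _ = (A * A).transpose := by
      rw [Matrix.mul_nonsing_inv _ hG, Matrix.mul_one, Matrix.mul_one, Matrix.transpose_mul]
    _ = -1 := by rw [hA]; simp

theorem isUnit_det_formMatrix {J : E →L[ℝ] E}
    (hpos : ∀ v, v ≠ 0 → 0 < g v v) (hJ : ∀ v, J (J v) = -v)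
    (Ω : E [⋀^Fin 2]→L[ℝ] ℝ) (hΩ : ∀ u v, Ω ![u, v] = g (J u) v) (b : Module.Basis ι ℝ E) :
    IsUnit (formMatrix Ω b).det := by
  apply Matrix.isUnit_det_of_right_inverse (B := -((Matrix.of fun r s => g (b r) (b s))⁻¹ *
    formMatrix Ω b * (Matrix.of fun r s => g (b r) (b s))⁻¹))
  rw [Matrix.mul_neg, formMatrix_mul_gram_inv hpos hJ Ω hΩ b, neg_neg]

/-- The Hodge star of the fundamental form is the contraction of the volume form with the
bivector inverse to the fundamental form. -/
theorem hodgeStar_fundamental {J : E →L[ℝ] E} (hsymm : ∀ u v, g u v = g v u)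
    (hpos : ∀ v, v ≠ 0 → 0 < g v v) (hJ : ∀ v, J (J v) = -v)
    (Ω : E [⋀^Fin 2]→L[ℝ] ℝ) (hΩ : ∀ u v, Ω ![u, v] = g (J u) v) (b : Module.Basis ι ℝ E)
    {l m : ℕ} (h : 2 + l = m) (vol : E [⋀^Fin m]→L[ℝ] ℝ) (w : Fin l → E) :
    hodgeStar h g vol b Ω w =
      -(1 / 2) * contractInv Ω b (fun u v => insertFirst h vol ![u, v] w) := by
  -- This identity is the source of the minus sign; the factor `1/2` is the `1/2!` in the definition
  -- of the star.
  have hK : (formMatrix Ω b)⁻¹ = -((Matrix.of fun r s => g (b r) (b s))⁻¹ *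
      formMatrix Ω b * (Matrix.of fun r s => g (b r) (b s))⁻¹) := by
    apply Matrix.inv_eq_right_inv
    rw [Matrix.mul_neg, formMatrix_mul_gram_inv hpos hJ Ω hΩ b, neg_neg]
  have hsym := gram_inv_symm hsymm b
  unfold contractInv
  rw [hK]
  set H := (Matrix.of fun r s => g (b r) (b s))⁻¹ with hH
  have hsym' : ∀ i j, H i j = H j i := fun i j => congrFun (congrFun hsym j) i
  have hpair : ∀ F : (Fin 2 → ι) → ℝ, ∑ p, F p = ∑ i, ∑ j, F ![i, j] := by
    intro F
    rw [← Fintype.sum_prod_type' (fun i j => F ![i, j])]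
    exact Fintype.sum_equiv (finTwoArrowEquiv ι) _ _ fun p => by
      congr 1
      ext j
      fin_cases j <;> rfl
  have hcomp : ∀ i j, b ∘ ![i, j] = ![b i, b j] := by
    intro i j
    ext k
    fin_cases k <;> rfl
  unfold hodgeStar
  simp only [ContinuousAlternatingMap.smul_apply, ContinuousAlternatingMap.sum_apply, ← hH,
    smul_eq_mul, hpair, hcomp, Fin.prod_univ_two, Matrix.cons_val_zero, Matrix.cons_val_one]
  have h1 : ∀ i j, (H * formMatrix Ω b * H) i j =
      ∑ p, ∑ q, H p i * H q j * Ω ![b p, b q] := by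
    intro i j
    rw [Matrix.mul_apply, Finset.sum_comm]
    refine Finset.sum_congr rfl fun q _ => ?_
    rw [Matrix.mul_apply, Finset.sum_mul]
    refine Finset.sum_congr rfl fun p _ => ?_
    rw [formMatrix_apply, hsym' i p]
    ring
  simp only [Matrix.neg_apply, h1, neg_mul, Finset.sum_neg_distrib, mul_neg, neg_neg,
    Finset.sum_mul, Nat.factorial]
  norm_num
  have h4 : ∀ F : ι → ι → ι → ι → ℝ, ∑ p, ∑ q, ∑ i, ∑ j, F p q i j =
      ∑ i, ∑ j, ∑ p, ∑ q, F p q i j := by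
    intro F
    have e1 : ∀ p, ∑ q, ∑ i, ∑ j, F p q i j = ∑ i, ∑ j, ∑ q, F p q i j := by
      intro p
      rw [Finset.sum_comm]
      exact Finset.sum_congr rfl fun i _ => Finset.sum_comm
    simp only [e1]
    rw [Finset.sum_comm]
    exact Finset.sum_congr rfl fun i _ => Finset.sum_comm
  exact h4 _

variable [FiniteDimensional ℝ E]

/-- The Hodge star is injective on the contractions of the volume form with vectors. -/
theorem eq_zero_of_hodgeStar_contract_eq_zero
    (hpos : ∀ v, v ≠ 0 → 0 < g v v) (b : Module.Basis ι ℝ E) {k m : ℕ} (h : k + 1 = m)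
    (hdim : Module.finrank ℝ E = m) {vol : E [⋀^Fin m]→L[ℝ] ℝ} (hvol : vol ≠ 0)
    (β : E [⋀^Fin k]→L[ℝ] ℝ) (D : E)
    (hβ : ∀ w, β w = castForm h.symm vol (Fin.cons D w))
    (hstar : hodgeStar h g vol b β = 0) : D = 0 := by
  subst h
  replace hβ : ∀ w, β w = vol (Fin.cons D w) := hβ
  have hG := isUnit_det_gram hpos b
  set H := (Matrix.of fun r s => g (b r) (b s))⁻¹ with hH
  have hHdet : IsUnit H.det := by
    rw [hH]
    exact Matrix.isUnit_nonsing_inv_det _ hG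
  -- `R` raises one index. The product of the entries of `H` is `R` applied in every slot of `β`;
  -- writing `D = R D'`, all slots of the top form carry `R`, and a factor `det R` comes out.
  let R : E →ₗ[ℝ] E := Matrix.toLin b b H
  have hRb : ∀ q, R (b q) = ∑ s, H s q • b s := fun q => Matrix.toLin_self b b H q
  have hRdet : LinearMap.det R ≠ 0 := by
    simp only [R, LinearMap.det_toLin]
    exact hHdet.ne_zero
  let R' : E ≃ₗ[ℝ] E := LinearEquiv.ofIsUnitDet (f := R) (v := b) (v' := b) (by
    simpa [R] using hHdet)
  set D' := R'.symm D with hD'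
  have hRD : R D' = D := R'.apply_symm_apply D
  have hraise : ∀ q : Fin k → ι, ∑ p : Fin k → ι, (∏ i, H (p i) (q i)) * β (b ∘ p) =
      LinearMap.det R * vol (Fin.cons D' (b ∘ q)) := by
    intro q
    have h1 : β (R ∘ b ∘ q) = ∑ p : Fin k → ι, (∏ i, H (p i) (q i)) * β (b ∘ p) := by
      have : (R ∘ b ∘ q) = fun i => ∑ s, H s (q i) • b s := funext fun i => hRb (q i)
      rw [this, β.map_sum]
      refine Finset.sum_congr rfl fun p _ => ?_
      rw [β.map_smul_univ (fun i => H (p i) (q i)) (fun i => b (p i))]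
      rfl
    rw [← h1, hβ, ← topForm_comp hdim]
    congr 1
    funext i
    refine Fin.cases ?_ (fun i => ?_) i
    · simp [hRD]
    · simp
  -- Evaluated at `D'`, the star of `β` is a nonzero constant times the sum of the squares of `vol
  -- (D', b q₁, …, b q_k)`, so each of these numbers vanishes.
  have hs' : hodgeStar rfl g vol b β (fun _ => D') = 0 := by rw [hstar]; rfl
  unfold hodgeStar at hs'
  rw [Finset.sum_comm] at hs'
  simp only [ContinuousAlternatingMap.smul_apply, ContinuousAlternatingMap.sum_apply, ← hH,
    smul_eq_mul, insertFirst_one_apply, ← Finset.sum_mul, hraise] at hs'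
  have hsq : ∑ q : Fin k → ι, vol (Fin.cons D' (b ∘ q)) * vol (Fin.cons D' (b ∘ q)) = 0 := by
    have h2 : ∑ q : Fin k → ι, vol (Fin.cons D' (b ∘ q)) * vol (Fin.cons D' (b ∘ q)) =
        (((Equiv.Perm.sign (finRotate (k + 1)) : ℤ) : ℝ) * LinearMap.det R)⁻¹ *
        ∑ q : Fin k → ι, LinearMap.det R * vol (Fin.cons D' (b ∘ q)) *
          (((Equiv.Perm.sign (finRotate (k + 1)) : ℤ) : ℝ) * vol (Fin.cons D' (b ∘ q))) := by
      rw [Finset.mul_sum]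
      refine Finset.sum_congr rfl fun q _ => ?_
      have : ((Equiv.Perm.sign (finRotate (k + 1)) : ℤ) : ℝ) ≠ 0 := by
        exact_mod_cast (Equiv.Perm.sign (finRotate (k + 1))).ne_zero
      field_simp
    rw [h2, mul_eq_zero]
    right
    refine (mul_eq_zero.1 hs').resolve_left ?_
    positivity
  have hz : ∀ q : Fin k → ι, vol (Fin.cons D' (b ∘ q)) = 0 := by
    intro q
    have := (Finset.sum_eq_zero_iff_of_nonneg fun q _ => mul_self_nonneg _).1 hsq q
      (Finset.mem_univ q)
    exact mul_self_eq_zero.1 this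
  have hD0 : D' = 0 := by
    apply eq_zero_of_topForm_cons_eq_zero hdim hvol
    have hcur : (vol.curryLeft D').toMultilinearMap = 0 := by
      apply Module.Basis.ext_multilinear (fun _ => b)
      intro q
      exact hz q
    intro w
    exact congrArg (fun F => F w) hcur
  rw [← hRD, hD0, map_zero]

end Hodge

/-! ### Differentiating the inverse of a matrix-valued function. -/

section MatrixDerivative

variable {E : Type*} [NormedAddCommGroup E] [NormedSpace ℝ E] {ι : Type*} [Fintype ι]
  [DecidableEq ι]

theorem differentiableAt_det {W : E → Matrix ι ι ℝ} {p : E}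
    (hW : ∀ i j, DifferentiableAt ℝ (fun y => W y i j) p) :
    DifferentiableAt ℝ (fun y => (W y).det) p := by
  simp only [Matrix.det_apply]
  refine DifferentiableAt.fun_sum fun σ _ => DifferentiableAt.fun_const_smul ?_ _
  exact (HasFDerivAt.finsetProd fun i _ => (hW _ _).hasFDerivAt).differentiableAt

theorem differentiableAt_inv_apply {W : E → Matrix ι ι ℝ} {p : E}
    (hW : ∀ i j, DifferentiableAt ℝ (fun y => W y i j) p) (hp : IsUnit (W p).det) (i j : ι) :
    DifferentiableAt ℝ (fun y => (W y)⁻¹ i j) p := by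
  simp only [Matrix.inv_def, Matrix.smul_apply, Ring.inverse_eq_inv', smul_eq_mul,
    Matrix.adjugate_apply]
  refine ((differentiableAt_det hW).inv hp.ne_zero).mul (differentiableAt_det fun r s => ?_)
  by_cases hr : r = j
  · subst hr
    simp only [Matrix.updateRow_self]
    exact differentiableAt_const _
  · simp only [Matrix.updateRow_ne hr]
    exact hW r s

/-- Differentiate `W⁻¹ W = 1`, which holds near `p` because the determinant stays nonzero there. -/
theorem fderiv_inv_apply {W : E → Matrix ι ι ℝ} {p : E}
    (hW : ∀ i j, DifferentiableAt ℝ (fun y => W y i j) p) (hp : IsUnit (W p).det) (u : E) :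
    (Matrix.of fun i j => fderiv ℝ (fun y => (W y)⁻¹ i j) p u) =
      -((W p)⁻¹ * (Matrix.of fun i j => fderiv ℝ (fun y => W y i j) p u) * (W p)⁻¹) := by
  set dK : Matrix ι ι ℝ := Matrix.of fun i j => fderiv ℝ (fun y => (W y)⁻¹ i j) p u
  set dW : Matrix ι ι ℝ := Matrix.of fun i j => fderiv ℝ (fun y => W y i j) p u
  have hK := differentiableAt_inv_apply hW hp
  have hev : ∀ᶠ y in 𝓝 p, IsUnit (W y).det := by
    filter_upwards [(differentiableAt_det hW).continuousAt.eventually_ne hp.ne_zero] with y hy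
    exact isUnit_iff_ne_zero.2 hy
  have h1 : dK * W p + (W p)⁻¹ * dW = 0 := by
    ext i k
    have hc : (fun y => ∑ j, (W y)⁻¹ i j * W y j k) =ᶠ[𝓝 p] fun _ => (1 : Matrix ι ι ℝ) i k := by
      filter_upwards [hev] with y hy
      rw [← Matrix.nonsing_inv_mul _ hy, Matrix.mul_apply]
    have h2 := hc.fderiv_eq (𝕜 := ℝ)
    rw [fderiv_fun_sum fun j _ => (hK i j).fun_mul (hW j k)] at h2
    have h3 := congrArg (fun F => F u) h2
    simp only [fderiv_fun_mul (hK i _) (hW _ k), fderiv_fun_const, Pi.zero_apply,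
      sum_apply, add_apply,
      smul_apply, zero_apply, smul_eq_mul] at h3
    rw [Matrix.add_apply, Matrix.mul_apply, Matrix.mul_apply, ← Finset.sum_add_distrib,
      Matrix.zero_apply, ← h3]
    refine Finset.sum_congr rfl fun j _ => ?_
    simp only [dK, dW, Matrix.of_apply]
    ring
  calc dK = dK * (W p * (W p)⁻¹) := by rw [Matrix.mul_nonsing_inv _ hp, Matrix.mul_one]
    _ = dK * W p * (W p)⁻¹ := by rw [Matrix.mul_assoc]
    _ = _ := by rw [eq_neg_of_add_eq_zero_left h1, Matrix.neg_mul]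

end MatrixDerivative

/-! ### The logarithmic derivative of the top power. -/

section WedgePowerDerivative

variable {E : Type*} [NormedAddCommGroup E] [NormedSpace ℝ E]

theorem differentiable_wedgePower_apply (n : ℕ) (v : Fin (2 * n) → E) :
    Differentiable ℝ fun Ω : E [⋀^Fin 2]→L[ℝ] ℝ => wedgePower n Ω v := by
  intro Ω
  simp only [wedgePower_apply]
  refine DifferentiableAt.const_mul (DifferentiableAt.fun_sum fun σ _ =>
    DifferentiableAt.const_mul ?_ _) _
  exact (HasFDerivAt.finsetProd fun i _ =>
    (ContinuousAlternatingMap.apply ℝ E ℝ _).hasFDerivAt).differentiableAt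

variable [FiniteDimensional ℝ E]

/-- In a basis, `det (1 + tA)` is a polynomial in `t` whose linear coefficient is the trace. -/
theorem hasDerivAt_det_one_add_smul (C : E →L[ℝ] E) :
    HasDerivAt (fun t : ℝ => LinearMap.det ((ContinuousLinearMap.id ℝ E + t • C : E →L[ℝ] E) :
      E →ₗ[ℝ] E)) (LinearMap.trace ℝ E C) 0 := by
  let b := Module.finBasis ℝ E
  set A := LinearMap.toMatrix b b (C : E →ₗ[ℝ] E) with hA
  have h1 : ∀ t : ℝ, LinearMap.det ((ContinuousLinearMap.id ℝ E + t • C : E →L[ℝ] E) :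
      E →ₗ[ℝ] E) = 1 + A.trace * t +
        (1 + (Polynomial.X : Polynomial ℝ) • A.map Polynomial.C).det.divX.divX.eval t * t ^ 2 := by
    intro t
    rw [← Matrix.det_one_add_smul, ← LinearMap.det_toMatrix b]
    congr 1
    rw [ContinuousLinearMap.toLinearMap_add, ContinuousLinearMap.toLinearMap_smul, map_add,
      map_smul, ContinuousLinearMap.coe_id, LinearMap.toMatrix_id]
  simp only [h1]
  rw [LinearMap.trace_eq_matrix_trace ℝ b]
  set q := (1 + (Polynomial.X : Polynomial ℝ) • A.map Polynomial.C).det.divX.divX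
  have h2 := (((hasDerivAt_id (0 : ℝ)).const_mul A.trace).const_add 1).add
    ((q.hasDerivAt 0).mul ((hasDerivAt_id (0 : ℝ)).pow 2))
  convert! h2 using 1
  simp [A]

/-- The logarithmic derivative of the top power of a nondegenerate `2`-form. -/
theorem fderiv_wedgePower_apply {n : ℕ} (hdim : Module.finrank ℝ E = 2 * n)
    (Ω B : E [⋀^Fin 2]→L[ℝ] ℝ) (C : E →L[ℝ] E) (hC : ∀ u v, Ω ![C u, v] = B ![u, v])
    (v : Fin (2 * n) → E) :
    fderiv ℝ (fun Ω : E [⋀^Fin 2]→L[ℝ] ℝ => wedgePower n Ω v) Ω B =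
      LinearMap.trace ℝ E C / 2 * wedgePower n Ω v := by
  -- Both slots contribute to the first variation of the pullback of `Ω` by `A t`, each giving `B`;
  -- the factor `1/2` makes the total `t • B`. The pullback multiplies the top power by `det (A t)`,
  -- whose derivative at `0` is `tr C / 2`.
  set A : ℝ → E →L[ℝ] E := fun t => ContinuousLinearMap.id ℝ E + t • ((1 / 2 : ℝ) • C)
  set Q : E [⋀^Fin 2]→L[ℝ] ℝ := Ω.compContinuousLinearMap ((1 / 2 : ℝ) • C)
  have hΩ2 : ∀ (Φ : E [⋀^Fin 2]→L[ℝ] ℝ) (w : Fin 2 → E), Φ w = twoFormBilin Φ (w 0) (w 1) := by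
    intro Φ w
    rw [twoFormBilin_apply]
    congr 1
    ext j
    fin_cases j <;> rfl
  have hcurve : ∀ t : ℝ, Ω.compContinuousLinearMap (A t) = Ω + t • B + t ^ 2 • Q := by
    intro t
    ext w
    have h1 : twoFormBilin Ω (C (w 0)) (w 1) = twoFormBilin B (w 0) (w 1) := hC _ _
    have h2 : twoFormBilin Ω (w 0) (C (w 1)) = twoFormBilin B (w 0) (w 1) := by
      simp only [twoFormBilin_apply]
      rw [twoForm_swap, hC, twoForm_swap, neg_neg]
    simp only [ContinuousAlternatingMap.compContinuousLinearMap_apply,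
      ContinuousAlternatingMap.add_apply, ContinuousAlternatingMap.smul_apply, Q, A]
    simp only [hΩ2 _ w, hΩ2 Ω (_ ∘ w)]
    simp only [Function.comp_apply, FunLike.coe_add, Pi.add_apply, ContinuousLinearMap.coe_id',
      id_eq, FunLike.coe_smul, Pi.smul_apply, map_add, map_smul, LinearMap.add_apply,
      LinearMap.smul_apply, smul_eq_mul, h1, h2]
    ring
  have hleft : HasDerivAt (fun t : ℝ => wedgePower n (Ω + t • B + t ^ 2 • Q) v)
      (fderiv ℝ (fun Ω : E [⋀^Fin 2]→L[ℝ] ℝ => wedgePower n Ω v) Ω B) 0 := by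
    have hc : HasDerivAt (fun t : ℝ => Ω + t • B + t ^ 2 • Q) B 0 := by
      have h3 := (((hasDerivAt_id (0 : ℝ)).smul_const B).const_add Ω).add
        (((hasDerivAt_id (0 : ℝ)).pow 2).smul_const Q)
      convert! h3 using 1
      simp
    have hF := (differentiable_wedgePower_apply n v
      (Ω + (0 : ℝ) • B + (0 : ℝ) ^ 2 • Q)).hasFDerivAt
    have := hF.comp_hasDerivAt (0 : ℝ) hc
    simpa using! this
  have hright : HasDerivAt (fun t : ℝ => wedgePower n (Ω + t • B + t ^ 2 • Q) v)
      (LinearMap.trace ℝ E C / 2 * wedgePower n Ω v) 0 := by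
    have h4 : ∀ t : ℝ, wedgePower n (Ω + t • B + t ^ 2 • Q) v =
        LinearMap.det (A t : E →ₗ[ℝ] E) * wedgePower n Ω v := by
      intro t
      rw [← hcurve, wedgePower_compContinuousLinearMap, ← topForm_comp hdim]
      rfl
    simp only [h4]
    have h5 := (hasDerivAt_det_one_add_smul ((1 / 2 : ℝ) • C)).mul_const (wedgePower n Ω v)
    convert! h5 using 1
    rw [ContinuousLinearMap.toLinearMap_smul, map_smul, smul_eq_mul]
    ring
  exact hleft.unique hright

end WedgePowerDerivative

/-! ### The differential of the star of `Ω` as a divergence, and the trace of `dΩ`. -/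

section StarOfSymplecticForm

variable {E : Type*} [NormedAddCommGroup E] [NormedSpace ℝ E]

theorem insertFirst_smul {k l m : ℕ} (h : k + l = m) (c : ℝ) (φ : E [⋀^Fin m]→L[ℝ] ℝ)
    (v : Fin k → E) : insertFirst h (c • φ) v = c • insertFirst h φ v := rfl

theorem extDeriv_two_apply {η : E → E [⋀^Fin 2]→L[ℝ] ℝ} {p : E} (u v w : E) :
    extDeriv η p ![u, v, w] = fderiv ℝ η p u ![v, w] - fderiv ℝ η p v ![u, w] +
      fderiv ℝ η p w ![u, v] := by
  have h0 : Fin.removeNth 0 ![u, v, w] = ![v, w] := by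
    ext i; fin_cases i <;> rfl
  have h1 : Fin.removeNth 1 ![u, v, w] = ![u, w] := by
    ext i; fin_cases i <;> rfl
  have h2 : Fin.removeNth 2 ![u, v, w] = ![u, v] := by
    ext i; fin_cases i <;> rfl
  rw [extDeriv, ContinuousAlternatingMap.alternatizeUncurryFin_apply, Fin.sum_univ_three, h0, h1,
    h2]
  simp
  ring

variable {ι : Type*} [Fintype ι]

variable [DecidableEq ι]

theorem differentiableAt_formMatrix {η : E → E [⋀^Fin 2]→L[ℝ] ℝ} {p : E}
    (hη : DifferentiableAt ℝ η p) (b : Module.Basis ι ℝ E) (i j : ι) :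
    DifferentiableAt ℝ (fun y => formMatrix (η y) b i j) p := by
  simp only [formMatrix_apply]
  exact (ContinuousAlternatingMap.apply ℝ E ℝ _).differentiableAt.comp p hη

theorem fderiv_formMatrix {η : E → E [⋀^Fin 2]→L[ℝ] ℝ} {p : E}
    (hη : DifferentiableAt ℝ η p) (b : Module.Basis ι ℝ E) (u : E) :
    (Matrix.of fun i j => fderiv ℝ (fun y => formMatrix (η y) b i j) p u) =
      formMatrix (fderiv ℝ η p u) b := by
  ext i j
  simp only [Matrix.of_apply, formMatrix_apply]
  have := ((ContinuousAlternatingMap.apply ℝ E ℝ ![b i, b j]).hasFDerivAt.comp p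
    hη.hasFDerivAt).fderiv
  exact congrArg (fun F => F u) this

theorem contractInv_curry_eq_zero_of_basis (Ω : E [⋀^Fin 2]→L[ℝ] ℝ) (T : E [⋀^Fin 3]→L[ℝ] ℝ)
    (b : Module.Basis ι ℝ E) (h : ∀ r, contractInv Ω b (fun u u' => T ![b r, u, u']) = 0) (v : E) :
    contractInv Ω b (fun u u' => T ![v, u, u']) = 0 := by
  let L : E →ₗ[ℝ] ℝ := ∑ i, ∑ j, (formMatrix Ω b)⁻¹ i j •
    (((ContinuousAlternatingMap.apply ℝ E ℝ ![b i, b j]).comp T.curryLeft : E →L[ℝ] ℝ) : E →ₗ[ℝ] ℝ)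
  have hL : ∀ v, L v = contractInv Ω b (fun u u' => T ![v, u, u']) := by
    intro v
    simp only [L, LinearMap.sum_apply, LinearMap.smul_apply, smul_eq_mul, contractInv]
    rfl
  have : L = 0 := b.ext fun r => by rw [hL, h]; rfl
  rw [← hL, this]
  rfl

variable [FiniteDimensional ℝ E]

theorem topForm_eq_smul {m : ℕ} (hdim : Module.finrank ℝ E = m) (φ ψ : E [⋀^Fin m]→L[ℝ] ℝ)
    {v : Fin m → E} (hv : ψ v ≠ 0) : φ = (φ v / ψ v) • ψ := by
  let b := Module.finBasisOfFinrankEq ℝ E hdim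
  have hb : ∀ (χ : E [⋀^Fin m]→L[ℝ] ℝ) w, χ w = χ b * b.det w := fun χ w =>
    congrArg (fun F => F w) (χ.toAlternatingMap.eq_smul_basis_det b)
  ext w
  rw [ContinuousAlternatingMap.smul_apply, smul_eq_mul, div_mul_eq_mul_div, eq_div_iff hv]
  rw [hb φ w, hb ψ v, hb φ v, hb ψ w]
  ring

theorem fderiv_topPower {n : ℕ} (hdim : Module.finrank ℝ E = 2 * n)
    {η : E → E [⋀^Fin 2]→L[ℝ] ℝ} {p : E} (hη : DifferentiableAt ℝ η p) (b : Module.Basis ι ℝ E)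
    (hdet : IsUnit (formMatrix (η p) b).det) (v : Fin (2 * n) → E) (u : E) :
    fderiv ℝ (fun y => wedgePower n (η y) v) p u =
      (formMatrix (fderiv ℝ η p u) b * (formMatrix (η p) b)⁻¹).trace / 2 *
        wedgePower n (η p) v := by
  set B := fderiv ℝ η p u
  set K := (formMatrix (η p) b)⁻¹
  -- `C` solves `η p (C x, y) = B (x, y)`. The transpose appears because the rows of `B W⁻¹` hold
  -- the coordinates of the vectors `C (b i)`.
  let C : E →ₗ[ℝ] E := Matrix.toLin b b (formMatrix B b * K).transpose
  have hC : ∀ x y, η p ![C x, y] = B ![x, y] := by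
    have h1 : (twoFormBilin (η p)).comp C LinearMap.id = twoFormBilin B := by
      apply LinearMap.BilinForm.ext_basis b
      intro i j
      have h2 : C (b i) = ∑ k, (formMatrix B b * K) i k • b k := by
        rw [Matrix.toLin_self]
        rfl
      rw [LinearMap.BilinForm.comp_apply, h2]
      simp only [map_sum, map_smul, LinearMap.id_apply, LinearMap.sum_apply, LinearMap.smul_apply,
        smul_eq_mul]
      have h3 := congrFun (congrFun (show formMatrix B b * K * formMatrix (η p) b =
        formMatrix B b by rw [Matrix.mul_assoc, Matrix.nonsing_inv_mul _ hdet, Matrix.mul_one]) i) j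
      rw [Matrix.mul_apply] at h3
      simpa [formMatrix_apply] using h3
    intro x y
    exact congrArg (fun F => F x y) h1
  have hcomp : fderiv ℝ (fun y => wedgePower n (η y) v) p u =
      fderiv ℝ (fun Ω : E [⋀^Fin 2]→L[ℝ] ℝ => wedgePower n Ω v) (η p) B := by
    have := ((differentiable_wedgePower_apply n v (η p)).hasFDerivAt.comp p hη.hasFDerivAt).fderiv
    exact congrArg (fun F => F u) this
  rw [hcomp, fderiv_wedgePower_apply hdim (η p) B (LinearMap.toContinuousLinearMap C) hC]
  congr 2
  rw [LinearMap.coe_toContinuousLinearMap, LinearMap.trace_eq_matrix_trace ℝ b,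
    LinearMap.toMatrix_toLin, Matrix.trace_transpose]

/-- The exterior derivative of the contraction of a volume form with a bivector field is the
contraction with its divergence. -/
theorem extDeriv_contract_bivector {l m : ℕ} (h : 2 + l = m) (hdim : Module.finrank ℝ E = m)
    (vol : E [⋀^Fin m]→L[ℝ] ℝ) {κ : Type*} [Fintype κ] (b : Module.Basis κ ℝ E)
    {H : κ → κ → E → ℝ} {p : E}
    (hH : ∀ i j, DifferentiableAt ℝ (H i j) p) (hskew : ∀ i j, H i j = -H j i)
    {α : E → E [⋀^Fin l]→L[ℝ] ℝ}
    (hα : ∀ᶠ y in 𝓝 p, α y = ∑ i, ∑ j, H i j y • insertFirst h vol ![b i, b j])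
    (w : Fin (l + 1) → E) :
    extDeriv α p w = castForm (show m = l + 1 + 1 by omega) vol
      (Fin.cons ((2 : ℝ) • ∑ i, (∑ j, fderiv ℝ (H i j) p (b j)) • b i) w) := by
  set φ := castForm (show m = l + 1 + 1 by omega) vol
  have hdim' : Module.finrank ℝ E = l + 1 + 1 := by omega
  have hd : fderiv ℝ α p = ∑ i, ∑ j, (fderiv ℝ (H i j) p).smulRight
      (insertFirst h vol ![b i, b j]) := by
    rw [Filter.EventuallyEq.fderiv_eq (f₁ := α)
      (f := fun y => ∑ i, ∑ j, H i j y • insertFirst h vol ![b i, b j]) hα]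
    have h1 : HasFDerivAt (fun y => ∑ i, ∑ j, H i j y • insertFirst h vol ![b i, b j])
        (∑ i, ∑ j, (fderiv ℝ (H i j) p).smulRight (insertFirst h vol ![b i, b j])) p :=
      HasFDerivAt.fun_sum fun i _ => HasFDerivAt.fun_sum fun j _ =>
        ((hH i j).hasFDerivAt.smul_const (insertFirst h vol ![b i, b j]))
    exact h1.fderiv
  -- This is `topForm_contract` for the functional `dH i j`, with `b i` inserted first and `b j`
  -- heading the remaining arguments: the sum over `w` is what is left after the `b j` term.
  have hterm : ∀ i j, ∑ k : Fin (l + 1), (-1) ^ (k : ℕ) * (fderiv ℝ (H i j) p (w k) *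
      insertFirst h vol ![b i, b j] (k.removeNth w)) =
      fderiv ℝ (H i j) p (b j) * φ (Fin.cons (b i) w) -
        fderiv ℝ (H i j) p (b i) * φ (Fin.cons (b j) w) := by
    intro i j
    have h1 := topForm_contract hdim' φ (fderiv ℝ (H i j) p) (b i) (Fin.cons (b j) w)
    rw [Fin.sum_univ_succ] at h1
    have h2 : ∀ k : Fin (l + 1), (Fin.removeNth k.succ (Fin.cons (b j) w : Fin (l + 1 + 1) → E)) =
        Fin.cons (b j) (k.removeNth w) := fun k =>
      funext (Fin.cases rfl fun _ => by simp [Fin.removeNth])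
    have h3 : (Fin.removeNth 0 (Fin.cons (b j) w : Fin (l + 1 + 1) → E)) = w := rfl
    simp only [h2, h3, Fin.val_zero, pow_zero, one_mul, Fin.cons_zero, Fin.val_succ,
      Fin.cons_succ, pow_succ, mul_neg, mul_one, neg_mul, Finset.sum_neg_distrib] at h1
    simp only [insertFirst_two_apply]
    linarith
  have hskew' : ∀ i j u, fderiv ℝ (H j i) p u = -fderiv ℝ (H i j) p u := by
    intro i j u
    rw [hskew j i, fderiv_neg]
    rfl
  have hcons : ∀ u, φ (Fin.cons u w) = φ.curryLeft u w := fun u => rfl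
  rw [extDeriv, ContinuousAlternatingMap.alternatizeUncurryFin_apply, hd, hcons, map_smul, map_sum]
  simp only [sum_apply, ContinuousLinearMap.smulRight_apply, ContinuousAlternatingMap.sum_apply,
    ContinuousAlternatingMap.smul_apply, smul_eq_mul, map_smul, Finset.smul_sum, zsmul_eq_mul,
    Int.cast_pow, Int.cast_neg, Int.cast_one, ← hcons]
  rw [Finset.sum_comm]
  have hswap : ∀ i, ∑ k : Fin (l + 1), ∑ j, (-1) ^ (k : ℕ) * (fderiv ℝ (H i j) p (w k) *
      insertFirst h vol ![b i, b j] (k.removeNth w)) =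
      ∑ j, (fderiv ℝ (H i j) p (b j) * φ (Fin.cons (b i) w) -
        fderiv ℝ (H i j) p (b i) * φ (Fin.cons (b j) w)) := by
    intro i
    rw [Finset.sum_comm]
    exact Finset.sum_congr rfl fun j _ => hterm i j
  simp only [hswap, Finset.sum_sub_distrib]
  -- By skewness of `H` the two divergence sums are opposite, so their difference doubles; this is
  -- the factor `2` in the statement.
  have h5 : ∑ i, ∑ j, fderiv ℝ (H i j) p (b i) * φ (Fin.cons (b j) w) =
      -∑ i, ∑ j, fderiv ℝ (H i j) p (b j) * φ (Fin.cons (b i) w) := by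
    rw [Finset.sum_comm, ← Finset.sum_neg_distrib]
    refine Finset.sum_congr rfl fun i _ => ?_
    rw [← Finset.sum_neg_distrib]
    refine Finset.sum_congr rfl fun j _ => ?_
    rw [hskew' i j]
    ring
  rw [h5, sub_neg_eq_add, ← two_mul, Finset.mul_sum]
  refine Finset.sum_congr rfl fun i _ => ?_
  rw [Finset.sum_mul]

/-- The exterior derivative of the Hodge star of `η` is the contraction of the volume form with a
vector `D` whose vanishing forces `dη` to be trace-free. -/
theorem exists_extDeriv_star {n l : ℕ} (hdim : Module.finrank ℝ E = 2 * n) (h : 2 + l = 2 * n)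
    (b : Module.Basis ι ℝ E) {η : E → E [⋀^Fin 2]→L[ℝ] ℝ} {p : E} (hη : DifferentiableAt ℝ η p)
    (hdet : IsUnit (formMatrix (η p) b).det) (hne : wedgePower n (η p) ≠ 0) (c : ℝ)
    {α : E → E [⋀^Fin l]→L[ℝ] ℝ}
    (hα : ∀ᶠ y in 𝓝 p, ∀ w, α y w = -(1 / 2) * contractInv (η y) b
      (fun u v => insertFirst h (c • wedgePower n (η y)) ![u, v] w)) :
    ∃ D : E, (∀ w, extDeriv α p w = castForm (show 2 * n = l + 1 + 1 by omega)
        (c • wedgePower n (η p)) (Fin.cons D w)) ∧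
      (D = 0 → ∀ v, contractInv (η p) b (fun u u' => extDeriv η p ![v, u, u']) = 0) := by
  obtain ⟨v₀, hv₀⟩ : ∃ v, wedgePower n (η p) v ≠ 0 := by
    by_contra! hcon
    exact hne (ContinuousAlternatingMap.ext hcon)
  -- Top forms are proportional, so the varying volume form is `f` times its value at `p`. The
  -- scalar `f` is absorbed into the bivector, which is then contracted with a constant volume form.
  set f : E → ℝ := fun y => wedgePower n (η y) v₀ / wedgePower n (η p) v₀
  have hf : ∀ y, wedgePower n (η y) = f y • wedgePower n (η p) := fun y =>
    topForm_eq_smul hdim _ _ hv₀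
  have hfp : f p = 1 := div_self hv₀
  have hfd : DifferentiableAt ℝ f p :=
    (((differentiable_wedgePower_apply n v₀ (η p)).comp p hη).mul_const _).congr_of_eventuallyEq
      (.of_forall fun y => div_eq_mul_inv _ _)
  set K : E → Matrix ι ι ℝ := fun y => (formMatrix (η y) b)⁻¹
  have hKd : ∀ i j, DifferentiableAt ℝ (fun y => K y i j) p :=
    differentiableAt_inv_apply (differentiableAt_formMatrix hη b) hdet
  set H : ι → ι → E → ℝ := fun i j y => -(1 / 2) * (f y * K y i j)
  have hHd : ∀ i j, DifferentiableAt ℝ (H i j) p := fun i j =>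
    (hfd.fun_mul (hKd i j)).const_mul _
  have hskew : ∀ i j, H i j = -H j i := by
    intro i j
    ext y
    simp only [H, Pi.neg_apply, K]
    rw [formMatrix_inv_swap]
    ring
  have hα' : ∀ᶠ y in 𝓝 p, α y =
      ∑ i, ∑ j, H i j y • insertFirst h (c • wedgePower n (η p)) ![b i, b j] := by
    filter_upwards [hα] with y hy
    ext w
    rw [hy, hf y]
    simp only [contractInv, ContinuousAlternatingMap.sum_apply, ContinuousAlternatingMap.smul_apply,
      Finset.mul_sum, insertFirst_smul, H, smul_eq_mul]
    refine Finset.sum_congr rfl fun i _ => Finset.sum_congr rfl fun j _ => ?_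
    ring
  refine ⟨_, extDeriv_contract_bivector h hdim (c • wedgePower n (η p)) b hHd hskew hα', ?_⟩
  intro hD
  set W := formMatrix (η p) b
  set a : ι → Matrix ι ι ℝ := fun k => formMatrix (fderiv ℝ η p (b k)) b with ha
  have hfder : ∀ k, fderiv ℝ f p (b k) = (a k * K p).trace / 2 := by
    intro k
    have h1 : fderiv ℝ f p = (wedgePower n (η p) v₀)⁻¹ •
        fderiv ℝ (fun y => wedgePower n (η y) v₀) p := by
      simp only [f, div_eq_inv_mul]
      exact fderiv_const_mul ((differentiable_wedgePower_apply n v₀ (η p)).comp p hη) _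
    rw [h1, smul_apply, fderiv_topPower hdim hη b hdet, smul_eq_mul]
    field_simp
    rfl
  have hKder : ∀ i j k, fderiv ℝ (fun y => K y i j) p (b k) = -(K p * a k * K p) i j := by
    intro i j k
    have h1 := fderiv_inv_apply (differentiableAt_formMatrix hη b) hdet (b k)
    rw [fderiv_formMatrix hη b] at h1
    exact congrFun (congrFun h1 i) j
  have hdiv : ∀ i, ∑ j, ((a j * K p).trace / 2 * K p i j - (K p * a j * K p) i j) = 0 := by
    have h1 : ∑ i, (∑ j, fderiv ℝ (H i j) p (b j)) • b i = 0 :=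
      (smul_eq_zero.1 hD).resolve_left two_ne_zero
    intro i
    have h2 := Fintype.linearIndependent_iff.1 b.linearIndependent _ h1 i
    have h3 : ∀ j, fderiv ℝ (H i j) p (b j) =
        -(1 / 2) * ((a j * K p).trace / 2 * K p i j - (K p * a j * K p) i j) := by
      intro j
      simp only [H]
      rw [fderiv_const_mul (hfd.fun_mul (hKd i j)), fderiv_fun_mul hfd (hKd i j)]
      simp only [smul_apply, add_apply, smul_eq_mul, hfder, hKder, hfp]
      ring
    simp only [h3, ← Finset.mul_sum] at h2
    exact (mul_eq_zero.1 h2).resolve_left (by norm_num)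
  have hWK : W * K p = 1 := Matrix.mul_nonsing_inv _ hdet
  -- Lowering the free index of the divergence with `W` cancels one factor `K`.
  have hlow : ∀ r, (a r * K p).trace / 2 - ∑ j, (a j * K p) r j = 0 := by
    intro r
    have h1 : ∑ i, W r i * ∑ j, ((a j * K p).trace / 2 * K p i j - (K p * a j * K p) i j) = 0 := by
      simp [hdiv]
    rw [← h1]
    simp only [Finset.mul_sum]
    rw [Finset.sum_comm]
    have h2 : ∀ j, ∑ i, W r i * ((a j * K p).trace / 2 * K p i j - (K p * a j * K p) i j) =
        (a j * K p).trace / 2 * (1 : Matrix ι ι ℝ) r j - (a j * K p) r j := by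
      intro j
      have h3 : W * (K p * a j * K p) = a j * K p := by
        rw [Matrix.mul_assoc (K p), ← Matrix.mul_assoc, hWK, Matrix.one_mul]
      rw [← h3, ← hWK, Matrix.mul_apply, Matrix.mul_apply, Finset.mul_sum,
        ← Finset.sum_sub_distrib]
      exact Finset.sum_congr rfl fun i _ => by ring
    simp only [h2, Finset.sum_sub_distrib, Matrix.one_apply]
    simp
  refine contractInv_curry_eq_zero_of_basis (η p) (extDeriv η p) b fun r => ?_
  have hK : ∀ i j, K p i j = -K p j i := formMatrix_inv_swap (η p) b
  have ha' : ∀ k i j, a k i j = fderiv ℝ η p (b k) ![b i, b j] := fun k i j =>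
    formMatrix_apply _ _ _ _
  have haskew : ∀ k i j, a k i j = -a k j i := by
    intro k i j
    rw [ha', ha', twoForm_swap]
  have h1 : (a r * K p).trace = -∑ i, ∑ j, K p i j * a r i j := by
    rw [Matrix.trace, ← Finset.sum_neg_distrib]
    refine Finset.sum_congr rfl fun i _ => ?_
    rw [Matrix.diag_apply, Matrix.mul_apply, ← Finset.sum_neg_distrib]
    refine Finset.sum_congr rfl fun j _ => ?_
    rw [hK j i]
    ring
  have h2 : ∑ j, (a j * K p) r j = -∑ i, ∑ j, K p i j * a i r j := by
    rw [← Finset.sum_neg_distrib]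
    refine Finset.sum_congr rfl fun i _ => ?_
    rw [Matrix.mul_apply, ← Finset.sum_neg_distrib]
    refine Finset.sum_congr rfl fun j _ => ?_
    rw [hK j i]
    ring
  have h3 : ∑ i, ∑ j, K p i j * a j r i = -∑ i, ∑ j, K p i j * a i r j := by
    rw [Finset.sum_comm, ← Finset.sum_neg_distrib]
    refine Finset.sum_congr rfl fun i _ => ?_
    rw [← Finset.sum_neg_distrib]
    refine Finset.sum_congr rfl fun j _ => ?_
    rw [hK j i]
    ring
  -- With `h3`, the trace of `dη` is the first sum minus twice the second, which is `-2` times the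
  -- left side of `hlow`.
  have h4 : contractInv (η p) b (fun u u' => extDeriv η p ![b r, u, u']) =
      (∑ i, ∑ j, K p i j * a r i j) - (∑ i, ∑ j, K p i j * a i r j) +
        ∑ i, ∑ j, K p i j * a j r i := by
    simp only [contractInv, ← Finset.sum_add_distrib, ← Finset.sum_sub_distrib]
    refine Finset.sum_congr rfl fun i _ => Finset.sum_congr rfl fun j _ => ?_
    rw [extDeriv_two_apply, ha', ha', ha']
    ring
  have h5 := hlow r
  rw [h1, h2] at h5
  rw [h4, h3]
  linarith

end StarOfSymplecticForm

/-! ### The pointwise identity: trace-free and closed twist forces `dη = 0`. -/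

section PluriclosedPointwise

variable {E : Type*} [NormedAddCommGroup E] [NormedSpace ℝ E]

theorem extDeriv_three_apply {S : E → E [⋀^Fin 3]→L[ℝ] ℝ} {p : E} (t u v w : E) :
    extDeriv S p ![t, u, v, w] = fderiv ℝ S p t ![u, v, w] - fderiv ℝ S p u ![t, v, w] +
      fderiv ℝ S p v ![t, u, w] - fderiv ℝ S p w ![t, u, v] := by
  have h0 : Fin.removeNth 0 ![t, u, v, w] = ![u, v, w] := by
    ext i; fin_cases i <;> rfl
  have h1 : Fin.removeNth 1 ![t, u, v, w] = ![t, v, w] := by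
    ext i; fin_cases i <;> rfl
  have h2 : Fin.removeNth 2 ![t, u, v, w] = ![t, u, w] := by
    ext i; fin_cases i <;> rfl
  have h3 : Fin.removeNth 3 ![t, u, v, w] = ![t, u, v] := by
    ext i; fin_cases i <;> rfl
  rw [extDeriv, ContinuousAlternatingMap.alternatizeUncurryFin_apply, Fin.sum_univ_four, h0, h1,
    h2, h3]
  have e3 : ((3 : Fin 4) : ℕ) = 3 := rfl
  have e2 : ((2 : Fin 4) : ℕ) = 2 := rfl
  simp only [e3, e2]
  simp
  ring

theorem threeForm_swap_last (T : E [⋀^Fin 3]→L[ℝ] ℝ) (u v w : E) :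
    T ![u, v, w] = -T ![u, w, v] := twoForm_swap (T.curryLeft u) v w

theorem threeForm_swap_first (T : E [⋀^Fin 3]→L[ℝ] ℝ) (u v w : E) :
    T ![u, v, w] = -T ![v, u, w] := by
  have h := T.toAlternatingMap.map_swap ![v, u, w] (show (0 : Fin 3) ≠ 1 by simp)
  have h2 : (![v, u, w] ∘ Equiv.swap (0 : Fin 3) 1 : Fin 3 → E) = ![u, v, w] := by
    ext i
    fin_cases i
    · simp
    · simp
    · simp [Equiv.swap_apply_of_ne_of_ne]
  rw [h2] at h
  exact h

theorem threeForm_cycle (T : E [⋀^Fin 3]→L[ℝ] ℝ) (u v w : E) :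
    T ![u, v, w] = T ![v, w, u] := by
  rw [threeForm_swap_first, threeForm_swap_last, neg_neg]

variable {ι : Type*} [Fintype ι] [DecidableEq ι]

/-- The Leibniz rule applied to a trace that vanishes near `p`, with `∂(W⁻¹) = -W⁻¹ (∂W) W⁻¹`. The
basis is constant, so only the inverse form and `S` are differentiated. -/
theorem sum_fderiv_trace_eq_zero {η : E → E [⋀^Fin 2]→L[ℝ] ℝ} {S : E → E [⋀^Fin 3]→L[ℝ] ℝ}
    {p : E} (hη : DifferentiableAt ℝ η p) (hS : DifferentiableAt ℝ S p) (b : Module.Basis ι ℝ E)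
    (hdet : IsUnit (formMatrix (η p) b).det)
    (htr : ∀ᶠ y in 𝓝 p, ∀ v, contractInv (η y) b (fun u u' => S y ![v, u, u']) = 0) (u v : E) :
    ∑ i, ∑ j, ((formMatrix (η p) b)⁻¹ i j * fderiv ℝ S p u ![v, b i, b j] -
      ((formMatrix (η p) b)⁻¹ * formMatrix (fderiv ℝ η p u) b * (formMatrix (η p) b)⁻¹) i j *
        S p ![v, b i, b j]) = 0 := by
  have hKd := differentiableAt_inv_apply (differentiableAt_formMatrix hη b) hdet
  have hSd : ∀ w : Fin 3 → E, HasFDerivAt (fun y => S y w)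
      ((ContinuousAlternatingMap.apply ℝ E ℝ w).comp (fderiv ℝ S p)) p := fun w =>
    (ContinuousAlternatingMap.apply ℝ E ℝ w).hasFDerivAt.comp p hS.hasFDerivAt
  have hz : (fun y => ∑ i, ∑ j, (formMatrix (η y) b)⁻¹ i j * S y ![v, b i, b j]) =ᶠ[𝓝 p]
      fun _ => (0 : ℝ) := by
    filter_upwards [htr] with y hy
    exact hy v
  have hsum : HasFDerivAt
      (fun y => ∑ i, ∑ j, (formMatrix (η y) b)⁻¹ i j * S y ![v, b i, b j]) _ p :=
    HasFDerivAt.fun_sum fun i _ => HasFDerivAt.fun_sum fun j _ =>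
      (hKd i j).hasFDerivAt.mul (hSd ![v, b i, b j])
  have h1 := hsum.unique ((hasFDerivAt_const (0 : ℝ) p).congr_of_eventuallyEq hz)
  have h2 := congrArg (fun F => F u) h1
  have h3 := fderiv_inv_apply (differentiableAt_formMatrix hη b) hdet u
  rw [fderiv_formMatrix hη b] at h3
  have h4 : ∀ i j, fderiv ℝ (fun y => (formMatrix (η y) b)⁻¹ i j) p u =
      -((formMatrix (η p) b)⁻¹ * formMatrix (fderiv ℝ η p u) b * (formMatrix (η p) b)⁻¹) i j :=
    fun i j => congrFun (congrFun h3 i) j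
  simp only [sum_apply, add_apply, smul_apply, smul_eq_mul, h4, zero_apply] at h2
  rw [← h2]
  refine Finset.sum_congr rfl fun i _ => Finset.sum_congr rfl fun j _ => ?_
  simp only [ContinuousLinearMap.comp_apply]
  change _ = _ * (fderiv ℝ S p u) ![v, b i, b j] + _
  ring

/-- Against an alternating tensor, each of the three signed permutations of `U` pairs to the same
number. -/
theorem sum_skew_three {ι : Type*} [Fintype ι] (T : ι → ι → ι → ℝ) (U : ι → ι → ι → ℝ)
    (hT : ∀ i j k, T i j k = -T j i k) (hT' : ∀ i j k, T i j k = T j k i) :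
    ∑ i, ∑ j, ∑ k, T i j k * (U i j k - U j i k + U k i j) =
      3 * ∑ i, ∑ j, ∑ k, T i j k * U i j k := by
  have h1 : ∑ i, ∑ j, ∑ k, T i j k * U j i k = -∑ i, ∑ j, ∑ k, T i j k * U i j k := by
    rw [Finset.sum_comm, ← Finset.sum_neg_distrib]
    refine Finset.sum_congr rfl fun i _ => ?_
    rw [← Finset.sum_neg_distrib]
    refine Finset.sum_congr rfl fun j _ => ?_
    rw [← Finset.sum_neg_distrib]
    refine Finset.sum_congr rfl fun k _ => ?_
    rw [hT j i]
    ring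
  have h2 : ∑ i, ∑ j, ∑ k, T i j k * U k i j = ∑ i, ∑ j, ∑ k, T i j k * U i j k := by
    calc ∑ i, ∑ j, ∑ k, T i j k * U k i j = ∑ i, ∑ k, ∑ j, T i j k * U k i j :=
          Finset.sum_congr rfl fun i _ => Finset.sum_comm
      _ = ∑ k, ∑ i, ∑ j, T i j k * U k i j := Finset.sum_comm
      _ = _ := by
        refine Finset.sum_congr rfl fun k _ => Finset.sum_congr rfl fun i _ =>
          Finset.sum_congr rfl fun j _ => ?_
        rw [hT' k i j]
  have h3 : ∀ i j k, T i j k * (U i j k - U j i k + U k i j) =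
      T i j k * U i j k - T i j k * U j i k + T i j k * U k i j := fun i j k => by ring
  simp only [h3, Finset.sum_add_distrib, Finset.sum_sub_distrib, h1, h2]
  ring

/-- The pointwise form of the vanishing theorem: if the `J`-twist `S` of `dη` is closed and
trace-free, then `dη = 0`. -/
theorem extDeriv_eq_zero_of_twist_closed {η : E → E [⋀^Fin 2]→L[ℝ] ℝ}
    {S : E → E [⋀^Fin 3]→L[ℝ] ℝ} {p : E} (hη : DifferentiableAt ℝ η p)
    (hS : DifferentiableAt ℝ S p) {g : E →L[ℝ] E →L[ℝ] ℝ} {J : E →L[ℝ] E}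
    (hJ : ∀ v, J (J v) = -v) (hΩ : ∀ u v, η p ![u, v] = g (J u) v)
    (b : Module.Basis ι ℝ E) (hb : ∀ i j, g (b i) (b j) = if i = j then 1 else 0)
    (htr : ∀ᶠ y in 𝓝 p, ∀ v, contractInv (η y) b (fun u u' => S y ![v, u, u']) = 0)
    (hcl : extDeriv S p = 0)
    (hSp : ∀ u v w, S p ![u, v, w] = extDeriv η p ![J u, J v, J w]) :
    extDeriv η p = 0 := by
  set W := formMatrix (η p) b
  set A := LinearMap.toMatrix b b (J : E →ₗ[ℝ] E)
  have hJb : ∀ c, J (b c) = ∑ d, A d c • b d := by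
    intro c
    conv_lhs => rw [← b.sum_repr (J (b c))]
    simp [A, LinearMap.toMatrix_apply]
  have hW : W = A.transpose := by
    ext r s
    have h1 : g (J (b r)) = ∑ d, A d r • g (b d) := by
      rw [hJb]
      simp only [map_sum, map_smul]
    simp only [W]
    rw [formMatrix_apply, hΩ, h1]
    simp [hb]
  have hA : A * A = -1 := by
    rw [← LinearMap.toMatrix_comp]
    have : (J : E →ₗ[ℝ] E) ∘ₗ (J : E →ₗ[ℝ] E) = -LinearMap.id := by
      ext v
      simp [hJ]
    rw [this, map_neg, LinearMap.toMatrix_id]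
  have hWskew : A.transpose = -A := by
    have := formMatrix_transpose (η p) b
    change W.transpose = -W at this
    rw [hW, Matrix.transpose_transpose] at this
    exact (neg_eq_iff_eq_neg.2 this).symm
  have hWA : W * A = 1 := by rw [hW, hWskew, Matrix.neg_mul, hA, neg_neg]
  have hdet : IsUnit W.det := Matrix.isUnit_det_of_right_inverse hWA
  have hK : W⁻¹ = A := Matrix.inv_eq_right_inv hWA
  have hAs : ∀ i j, A i j = -A j i := fun i j => congrFun (congrFun hWskew j) i
  set U : ι → ι → ι → ℝ := fun c i j => fderiv ℝ η p (J (b c)) ![J (b i), J (b j)] with hU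
  set Q : ι → ι → ι → ℝ := fun c i j => S p ![b c, b i, b j] with hQ
  -- The trace condition is differentiated along `J (b c)` with `b c` in the free slot. At `p` the
  -- basis is orthonormal, so the inverse of `Ω` is the skew matrix `A` of `J`, and `A B A = -Aᵀ B
  -- A` evaluates the derivative of `Ω` on `J`-images.
  have htrace : ∀ c, ∑ i, ∑ j, A i j * fderiv ℝ S p (J (b c)) ![b c, b i, b j] =
      -∑ i, ∑ j, Q c i j * U c i j := by
    intro c
    have h1 := sum_fderiv_trace_eq_zero hη hS b hdet htr (J (b c)) (b c)
    rw [show (formMatrix (η p) b)⁻¹ = A from hK] at h1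
    have h2 : ∀ i j, (A * formMatrix (fderiv ℝ η p (J (b c))) b * A) i j = -U c i j := by
      intro i j
      set B := fderiv ℝ η p (J (b c))
      have h3 : U c i j = twoFormBilin B (J (b i)) (J (b j)) := rfl
      rw [h3, hJb, hJb, Matrix.mul_apply]
      simp only [map_sum, map_smul, LinearMap.sum_apply, LinearMap.smul_apply, smul_eq_mul,
        Matrix.mul_apply, Finset.sum_mul, Finset.mul_sum]
      rw [Finset.sum_comm, ← Finset.sum_neg_distrib]
      rw [Finset.sum_comm]
      refine Finset.sum_congr rfl fun k _ => ?_
      rw [← Finset.sum_neg_distrib]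
      refine Finset.sum_congr rfl fun l _ => ?_
      rw [formMatrix_apply, twoFormBilin_apply, hAs i]
      ring
    simp only [h2, Finset.sum_sub_distrib] at h1
    rw [sub_eq_zero] at h1
    rw [h1, ← Finset.sum_neg_distrib]
    refine Finset.sum_congr rfl fun i _ => ?_
    rw [← Finset.sum_neg_distrib]
    exact Finset.sum_congr rfl fun j _ => by ring
  set X := ∑ c, ∑ i, ∑ j, A i j * fderiv ℝ S p (J (b c)) ![b c, b i, b j] with hX
  have hexp : ∀ (c : ι) (v w : E), fderiv ℝ S p (J (b c)) ![b c, v, w] =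
      ∑ d, A d c * fderiv ℝ S p (b d) ![b c, v, w] := by
    intro c v w
    rw [hJb]
    simp [ContinuousAlternatingMap.sum_apply]
  have hX' : X = ∑ d, ∑ c, ∑ i, ∑ j, A d c * A i j * fderiv ℝ S p (b d) ![b c, b i, b j] := by
    rw [hX, Finset.sum_comm]
    rw [Finset.sum_comm]
    calc ∑ c, ∑ i, ∑ j, A i j * fderiv ℝ S p (J (b c)) ![b c, b i, b j]
        = ∑ c, ∑ i, ∑ d, ∑ j, A d c * A i j * fderiv ℝ S p (b d) ![b c, b i, b j] := by
          refine Finset.sum_congr rfl fun c _ => Finset.sum_congr rfl fun i _ => ?_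
          rw [Finset.sum_comm]
          refine Finset.sum_congr rfl fun j _ => ?_
          rw [hexp, Finset.mul_sum]
          exact Finset.sum_congr rfl fun d _ => by ring
      _ = ∑ c, ∑ d, ∑ i, ∑ j, A d c * A i j * fderiv ℝ S p (b d) ![b c, b i, b j] :=
          Finset.sum_congr rfl fun c _ => Finset.sum_comm
      _ = _ := Finset.sum_comm
  -- In the contraction of `dS` with `A d c * A i j`, the skewness of `A` and the exchange of the
  -- two index pairs make all four terms of `dS` equal to `X`, so `4X = 0`.
  have hX0 : X = 0 := by
    have hcl' : ∑ d, ∑ c, ∑ i, ∑ j, A d c * A i j * extDeriv S p ![b d, b c, b i, b j] = 0 := by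
      simp [hcl]
    have t2 : ∑ d, ∑ c, ∑ i, ∑ j, A d c * A i j * fderiv ℝ S p (b c) ![b d, b i, b j] = -X := by
      rw [hX', Finset.sum_comm, ← Finset.sum_neg_distrib]
      refine Finset.sum_congr rfl fun d _ => ?_
      rw [← Finset.sum_neg_distrib]
      refine Finset.sum_congr rfl fun c _ => ?_
      rw [← Finset.sum_neg_distrib]
      refine Finset.sum_congr rfl fun i _ => ?_
      rw [← Finset.sum_neg_distrib]
      refine Finset.sum_congr rfl fun j _ => ?_
      rw [hAs c d]
      ring
    have hswap : ∀ F : ι → ι → ι → ι → ℝ, ∑ d, ∑ c, ∑ i, ∑ j, F d c i j =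
        ∑ d, ∑ c, ∑ i, ∑ j, F i j d c := by
      intro F
      calc ∑ d, ∑ c, ∑ i, ∑ j, F d c i j = ∑ x : ι × ι, ∑ y : ι × ι, F x.1 x.2 y.1 y.2 := by
            simp only [Fintype.sum_prod_type]
        _ = ∑ y : ι × ι, ∑ x : ι × ι, F x.1 x.2 y.1 y.2 := Finset.sum_comm
        _ = _ := by simp only [Fintype.sum_prod_type]
    have t3 : ∑ d, ∑ c, ∑ i, ∑ j, A d c * A i j * fderiv ℝ S p (b i) ![b d, b c, b j] = X := by
      rw [hX', hswap]
      refine Finset.sum_congr rfl fun d _ => Finset.sum_congr rfl fun c _ =>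
        Finset.sum_congr rfl fun i _ => Finset.sum_congr rfl fun j _ => ?_
      rw [threeForm_cycle _ (b c)]
      ring
    have t4 : ∑ d, ∑ c, ∑ i, ∑ j, A d c * A i j * fderiv ℝ S p (b j) ![b d, b c, b i] = -X := by
      rw [← t3, ← Finset.sum_neg_distrib]
      refine Finset.sum_congr rfl fun d _ => ?_
      rw [← Finset.sum_neg_distrib]
      refine Finset.sum_congr rfl fun c _ => ?_
      rw [Finset.sum_comm, ← Finset.sum_neg_distrib]
      refine Finset.sum_congr rfl fun i _ => ?_
      rw [← Finset.sum_neg_distrib]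
      refine Finset.sum_congr rfl fun j _ => ?_
      rw [hAs j i]
      ring
    have e : ∀ d c i j, A d c * A i j * extDeriv S p ![b d, b c, b i, b j] =
        A d c * A i j * fderiv ℝ S p (b d) ![b c, b i, b j] -
        A d c * A i j * fderiv ℝ S p (b c) ![b d, b i, b j] +
        A d c * A i j * fderiv ℝ S p (b i) ![b d, b c, b j] -
        A d c * A i j * fderiv ℝ S p (b j) ![b d, b c, b i] := by
      intro d c i j
      rw [extDeriv_three_apply]
      ring
    simp only [e, Finset.sum_add_distrib, Finset.sum_sub_distrib, t2, t3, t4, ← hX'] at hcl'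
    linarith
  have hQU : ∑ c, ∑ i, ∑ j, Q c i j * U c i j = 0 := by
    rw [hX] at hX0
    simp only [htrace, Finset.sum_neg_distrib, neg_eq_zero] at hX0
    exact hX0
  -- Since `S p` is the `J`-twist of `dη`, `Q` is the alternating sum of `U`, so `|Q|²` is three
  -- times the vanishing pairing of `Q` with `U`.
  have hQsq : ∑ c, ∑ i, ∑ j, Q c i j * Q c i j = 0 := by
    have h1 : ∀ c i j, Q c i j = U c i j - U i c j + U j c i := by
      intro c i j
      simp only [hQ, hU]
      rw [hSp, extDeriv_two_apply]
    have h2 := sum_skew_three Q U (fun i j k => threeForm_swap_first _ _ _ _)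
      (fun i j k => threeForm_cycle _ _ _ _)
    rw [hQU, mul_zero] at h2
    simpa only [← h1] using h2
  have hQ0 : ∀ c i j, Q c i j = 0 := by
    intro c i j
    have h1 := (Finset.sum_eq_zero_iff_of_nonneg fun c _ => Finset.sum_nonneg fun i _ =>
      Finset.sum_nonneg fun j _ => mul_self_nonneg (Q c i j)).1 hQsq c (Finset.mem_univ _)
    have h2 := (Finset.sum_eq_zero_iff_of_nonneg fun i _ =>
      Finset.sum_nonneg fun j _ => mul_self_nonneg (Q c i j)).1 h1 i (Finset.mem_univ _)
    have h3 := (Finset.sum_eq_zero_iff_of_nonneg fun j _ =>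
      mul_self_nonneg (Q c i j)).1 h2 j (Finset.mem_univ _)
    exact mul_self_eq_zero.1 h3
  have hvec : ∀ v : Fin 3 → E, v = ![v 0, v 1, v 2] := by
    intro v
    ext k
    fin_cases k <;> rfl
  have hS0 : (S p).toMultilinearMap = 0 := by
    apply Module.Basis.ext_multilinear (fun _ => b)
    intro q
    change S p (fun k => b (q k)) = 0
    rw [hvec fun k => b (q k)]
    exact hQ0 _ _ _
  have hS0' : ∀ v, S p v = 0 := fun v => congrArg (fun F => F v) hS0
  ext v
  -- Evaluating at `-J v` undoes the twist, because `J (-J v) = v`.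
  have h1 := hS0' ![-J (v 0), -J (v 1), -J (v 2)]
  rw [hSp] at h1
  simp only [map_neg, hJ, neg_neg] at h1
  rw [hvec v, h1]
  rfl

end PluriclosedPointwise

/-! ### Differential forms and the exterior derivative in charts. -/

section Charts

variable {E : Type*} [NormedAddCommGroup E] [NormedSpace ℝ E]
  {M : Type*} [TopologicalSpace M] [ChartedSpace E M]

theorem two_le_infty : (2 : WithTop ℕ∞) ≤ ∞ :=
  (WithTop.coe_le_coe.2 le_top : ((2 : ℕ∞) : WithTop ℕ∞) ≤ ∞)

/-- The derivative of the inverse of the chart at `x₀`. -/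
def chartInvDeriv (x₀ : M) (y : E) : E →L[ℝ] E :=
  mfderiv 𝓘(ℝ, E) 𝓘(ℝ, E) (extChartAt 𝓘(ℝ, E) x₀).symm y

/-- The derivative of the chart at `x₀`, at the point with coordinates `y`. -/
def chartDeriv (x₀ : M) (y : E) : E →L[ℝ] E :=
  mfderiv 𝓘(ℝ, E) 𝓘(ℝ, E) (extChartAt 𝓘(ℝ, E) x₀) ((extChartAt 𝓘(ℝ, E) x₀).symm y)

theorem inChart_apply {k : ℕ} (α : DiffForm E M k) (x₀ : M) (y : E) (v : Fin k → E) :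
    inChart α x₀ y v =
      (show E [⋀^Fin k]→L[ℝ] ℝ from α ((extChartAt 𝓘(ℝ, E) x₀).symm y))
        (chartInvDeriv x₀ y ∘ v) := rfl

theorem target_mem_nhds {x₀ : M} {y : E} (hy : y ∈ (extChartAt 𝓘(ℝ, E) x₀).target) :
    (extChartAt 𝓘(ℝ, E) x₀).target ∈ 𝓝 y :=
  (isOpen_extChartAt_target x₀).mem_nhds hy

variable [IsManifold 𝓘(ℝ, E) ∞ M]

theorem chartDeriv_chartInvDeriv (x₀ : M) {y : E} (hy : y ∈ (extChartAt 𝓘(ℝ, E) x₀).target)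
    (v : E) : chartDeriv x₀ y (chartInvDeriv x₀ y v) = v := by
  have : IsManifold 𝓘(ℝ, E) 1 M := IsManifold.of_le (n := ∞) (by simp)
  have h := mfderiv_extChartAt_comp_mfderivWithin_extChartAt_symm (I := 𝓘(ℝ, E)) hy
  rw [ModelWithCorners.range_eq_univ, mfderivWithin_univ] at h
  exact congrArg (fun F : E →L[ℝ] E => F v) h

theorem chartInvDeriv_chartDeriv (x₀ : M) {y : E} (hy : y ∈ (extChartAt 𝓘(ℝ, E) x₀).target)
    (v : E) : chartInvDeriv x₀ y (chartDeriv x₀ y v) = v := by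
  have : IsManifold 𝓘(ℝ, E) 1 M := IsManifold.of_le (n := ∞) (by simp)
  have h := mfderivWithin_extChartAt_symm_comp_mfderiv_extChartAt (I := 𝓘(ℝ, E)) hy
  rw [ModelWithCorners.range_eq_univ, mfderivWithin_univ] at h
  exact congrArg (fun F : E →L[ℝ] E => F v) h

theorem mfderiv_extChartAt_center (x₀ : M) :
    (mfderiv 𝓘(ℝ, E) 𝓘(ℝ, E) (extChartAt 𝓘(ℝ, E) x₀) x₀ : E →L[ℝ] E) =
      ContinuousLinearMap.id ℝ E := by
  have : IsManifold 𝓘(ℝ, E) 1 M := IsManifold.of_le (n := ∞) (by simp)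
  exact mfderiv_extChartAt_self (I := 𝓘(ℝ, E)) (x := x₀)

theorem chartInvDeriv_center (x₀ : M) :
    chartInvDeriv x₀ (extChartAt 𝓘(ℝ, E) x₀ x₀) = ContinuousLinearMap.id ℝ E := by
  have : IsManifold 𝓘(ℝ, E) 1 M := IsManifold.of_le (n := ∞) (by simp)
  have h := mfderivWithin_range_extChartAt_symm (I := 𝓘(ℝ, E)) (x := x₀)
  rw [ModelWithCorners.range_eq_univ, mfderivWithin_univ] at h
  exact h

theorem inChart_center {k : ℕ} (α : DiffForm E M k) (x₀ : M) :
    inChart α x₀ (extChartAt 𝓘(ℝ, E) x₀ x₀) = α x₀ := by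
  refine ContinuousAlternatingMap.ext fun v => ?_
  rw [inChart_apply, chartInvDeriv_center]
  have : ∀ m : M, m = x₀ → (show E [⋀^Fin k]→L[ℝ] ℝ from α m) (ContinuousLinearMap.id ℝ E ∘ v) =
      (show E [⋀^Fin k]→L[ℝ] ℝ from α x₀) v := by
    rintro _ rfl
    rfl
  exact this _ (extChartAt_to_inv x₀)

theorem exteriorD_eq_extDeriv {k : ℕ} (α : DiffForm E M k) (x₀ : M) :
    exteriorD α x₀ = extDeriv (inChart α x₀) (extChartAt 𝓘(ℝ, E) x₀ x₀) := by
  refine ContinuousAlternatingMap.ext fun v => ?_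
  change extDeriv (inChart α x₀) (extChartAt 𝓘(ℝ, E) x₀ x₀)
    ((mfderiv 𝓘(ℝ, E) 𝓘(ℝ, E) (extChartAt 𝓘(ℝ, E) x₀) x₀ : E →L[ℝ] E) ∘ v) = _
  rw [mfderiv_extChartAt_center]
  rfl

/-- The exterior derivative can be computed in any chart. -/
theorem inChart_exteriorD {k : ℕ} (α : DiffForm E M k) (x₀ : M) {y₁ : E}
    (hy₁ : y₁ ∈ (extChartAt 𝓘(ℝ, E) x₀).target)
    (hα : ∀ m : M, DifferentiableAt ℝ (inChart α m) (extChartAt 𝓘(ℝ, E) m m)) :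
    inChart (exteriorD α) x₀ y₁ = extDeriv (inChart α x₀) y₁ := by
  have hM1 : IsManifold 𝓘(ℝ, E) 1 M := IsManifold.of_le (n := ∞) (by simp)
  set m := (extChartAt 𝓘(ℝ, E) x₀).symm y₁ with hm
  -- `exteriorD α` at `m` is defined through the chart at `m`. The transition map `τ` compares it
  -- with the chart at `x₀`, and `d` commutes with pullback along `τ`.
  set τ : E → E := fun y => extChartAt 𝓘(ℝ, E) m ((extChartAt 𝓘(ℝ, E) x₀).symm y)
  have hev : ∀ᶠ y in 𝓝 y₁, y ∈ (extChartAt 𝓘(ℝ, E) x₀).target ∧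
      (extChartAt 𝓘(ℝ, E) x₀).symm y ∈ (extChartAt 𝓘(ℝ, E) m).source := by
    refine (Filter.eventually_of_mem (target_mem_nhds hy₁) fun y hy => hy).and ?_
    exact (continuousAt_extChartAt_symm'' hy₁).eventually_mem
      (extChartAt_source_mem_nhds (I := 𝓘(ℝ, E)) m)
  have hsm : ∀ y ∈ (extChartAt 𝓘(ℝ, E) x₀).target,
      MDifferentiableAt 𝓘(ℝ, E) 𝓘(ℝ, E) (extChartAt 𝓘(ℝ, E) x₀).symm y := by
    intro y hy
    have := mdifferentiableWithinAt_extChartAt_symm (I := 𝓘(ℝ, E)) hy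
    rwa [ModelWithCorners.range_eq_univ, mdifferentiableWithinAt_univ] at this
  have hτC : ContDiffAt ℝ 2 τ y₁ := by
    have h1 : ContMDiffAt 𝓘(ℝ, E) 𝓘(ℝ, E) 2 (extChartAt 𝓘(ℝ, E) x₀).symm y₁ :=
      ((contMDiffOn_extChartAt_symm (n := ∞) x₀).contMDiffAt (target_mem_nhds hy₁)).of_le
        two_le_infty
    have h2 : ContMDiffAt 𝓘(ℝ, E) 𝓘(ℝ, E) 2 (extChartAt 𝓘(ℝ, E) m) m :=
      (contMDiffAt_extChartAt (n := ∞)).of_le two_le_infty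
    exact (ContMDiffAt.comp y₁ h2 h1).contDiffAt
  have hfd : ∀ y, y ∈ (extChartAt 𝓘(ℝ, E) x₀).target →
      (extChartAt 𝓘(ℝ, E) x₀).symm y ∈ (extChartAt 𝓘(ℝ, E) m).source → ∀ v,
      fderiv ℝ τ y v = (mfderiv 𝓘(ℝ, E) 𝓘(ℝ, E) (extChartAt 𝓘(ℝ, E) m)
        ((extChartAt 𝓘(ℝ, E) x₀).symm y) : E →L[ℝ] E) (chartInvDeriv x₀ y v) := by
    intro y hy hy' v
    rw [extChartAt_source] at hy'
    have h1 := mfderiv_comp y (mdifferentiableAt_extChartAt (I := 𝓘(ℝ, E)) hy') (hsm y hy)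
    rw [mfderiv_eq_fderiv] at h1
    exact congrArg (fun F : E →L[ℝ] E => F v) h1
  have hpull : inChart α x₀ =ᶠ[𝓝 y₁] fun y =>
      (inChart α m (τ y)).compContinuousLinearMap (fderiv ℝ τ y) := by
    filter_upwards [hev] with y hy
    refine ContinuousAlternatingMap.ext fun v => ?_
    rw [ContinuousAlternatingMap.compContinuousLinearMap_apply, inChart_apply, inChart_apply]
    have h1 : (extChartAt 𝓘(ℝ, E) m).symm (τ y) = (extChartAt 𝓘(ℝ, E) x₀).symm y :=
      (extChartAt 𝓘(ℝ, E) m).left_inv hy.2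
    have h2 : ∀ u, chartInvDeriv m (τ y) (fderiv ℝ τ y u) = chartInvDeriv x₀ y u := by
      intro u
      have h3 := chartInvDeriv_chartDeriv m (y := τ y)
        ((extChartAt 𝓘(ℝ, E) m).map_source hy.2) (chartInvDeriv x₀ y u)
      unfold chartDeriv at h3
      rw [h1] at h3
      rw [hfd y hy.1 hy.2]
      exact h3
    have h3 : (chartInvDeriv m (τ y) ∘ fderiv ℝ τ y ∘ v) = chartInvDeriv x₀ y ∘ v :=
      funext fun i => h2 (v i)
    rw [h3]
    have : ∀ a b : M, a = b → ∀ w : Fin k → E, (show E [⋀^Fin k]→L[ℝ] ℝ from α a) w =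
        (show E [⋀^Fin k]→L[ℝ] ℝ from α b) w := by
      rintro _ _ rfl w
      rfl
    exact this _ _ h1.symm _
  have hατ : DifferentiableAt ℝ (inChart α m) (τ y₁) := hα m
  rw [hpull.extDeriv_eq, extDeriv_pullback (r := 2) hατ hτC (by simp)]
  refine ContinuousAlternatingMap.ext fun v => ?_
  rw [inChart_apply, ContinuousAlternatingMap.compContinuousLinearMap_apply]
  -- The chart at `m` has derivative the identity at its own centre, so `dτ` there reduces to the
  -- derivative of the inverse chart at `x₀`.
  have h4 : (fderiv ℝ τ y₁ : E → E) = chartInvDeriv x₀ y₁ := by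
    funext u
    rw [hfd y₁ hy₁ (mem_extChartAt_source m)]
    have := mfderiv_extChartAt_center (E := E) m
    exact congrArg (fun F : E →L[ℝ] E => F (chartInvDeriv x₀ y₁ u)) this
  rw [h4]
  exact congrArg (fun F : E [⋀^Fin (k + 1)]→L[ℝ] ℝ => F (chartInvDeriv x₀ y₁ ∘ v))
    (exteriorD_eq_extDeriv α m)

end Charts

/-! ### Regularity of the metric, `J` and `Ω` in charts. -/

section HermitianCharts

variable {E : Type*} [NormedAddCommGroup E] [NormedSpace ℝ E]

/-- The alternating form attached to a bilinear form, normalized so that it sends a skew form to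
itself. -/
def alternatizeBilin : (E →L[ℝ] E →L[ℝ] ℝ) →L[ℝ] E [⋀^Fin 2]→L[ℝ] ℝ :=
  (1 / 2 : ℝ) • (ContinuousAlternatingMap.alternatizeUncurryFinCLM ℝ E ℝ).comp
    (ContinuousLinearMap.compL ℝ E (E →L[ℝ] ℝ) (E [⋀^Fin 1]→L[ℝ] ℝ)
      (ContinuousAlternatingMap.ofSubsingletonLIE
        (0 : Fin 1)).toContinuousLinearEquiv.toContinuousLinearMap)

theorem alternatizeBilin_apply (B : E →L[ℝ] E →L[ℝ] ℝ) (v : Fin 2 → E) :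
    alternatizeBilin B v = 1 / 2 * (B (v 0) (v 1) - B (v 1) (v 0)) := by
  simp only [alternatizeBilin, smul_apply, ContinuousLinearMap.comp_apply,
    ContinuousAlternatingMap.smul_apply, smul_eq_mul,
    ContinuousAlternatingMap.alternatizeUncurryFinCLM_apply,
    ContinuousAlternatingMap.alternatizeUncurryFin_apply]
  refine congrArg (fun z => 1 / 2 * z) ((Fin.sum_univ_two _).trans ?_)
  change (1 : ℤ) • B (v 0) (v 1) + (-1 : ℤ) • B (v 1) (v 0) = _
  simp
  ring

theorem contDiffAt_alternatizeBilin {f : E → E →L[ℝ] E →L[ℝ] ℝ} {p : E}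
    (hf : ContDiffAt ℝ 2 f p) : ContDiffAt ℝ 2 (fun y => alternatizeBilin (f y)) p := by
  have h : ContDiff ℝ 2 (fun B : E →L[ℝ] E →L[ℝ] ℝ => alternatizeBilin B) :=
    ContinuousLinearMap.contDiff _
  exact h.contDiffAt.comp p hf

variable {M : Type*} [TopologicalSpace M] [ChartedSpace E M] [IsManifold 𝓘(ℝ, E) ∞ M]

namespace HermitianStructure

variable (S : HermitianStructure E M)

/-- The metric at a point, as a bilinear form on the model space. -/
def metricAt (x : M) : E →L[ℝ] E →L[ℝ] ℝ := S.g.inner x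

/-- The complex structure at a point, as an endomorphism of the model space. -/
def JAt (x : M) : E →L[ℝ] E := S.J x

/-- The fundamental form at a point, as a form on the model space. -/
def formAt (x : M) : E [⋀^Fin 2]→L[ℝ] ℝ := S.fundamentalForm x

theorem metricAt_symm (x : M) (u v : E) : S.metricAt x u v = S.metricAt x v u := S.g.symm x u v

theorem metricAt_pos (x : M) (v : E) (hv : v ≠ 0) : 0 < S.metricAt x v v := S.g.pos x v hv

theorem JAt_JAt (x : M) (v : E) : S.JAt x (S.JAt x v) = -v := S.J_sq x v

theorem metricAt_J_J (x : M) (u v : E) : S.metricAt x (S.JAt x u) (S.JAt x v) = S.metricAt x u v :=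
  S.g_J_J x u v

theorem formAt_apply_pair (x : M) (u v : E) :
    S.formAt x ![u, v] = S.metricAt x (S.JAt x u) v := rfl

theorem formAt_J_J (x : M) (u v : E) :
    S.formAt x ![S.JAt x u, S.JAt x v] = S.formAt x ![u, v] := by
  rw [formAt_apply_pair, formAt_apply_pair, metricAt_J_J]

/-- The complex structure in a chart. -/
def chartJ (x₀ : M) (y : E) : E →L[ℝ] E :=
  (chartDeriv x₀ y).comp ((S.JAt ((extChartAt 𝓘(ℝ, E) x₀).symm y)).comp (chartInvDeriv x₀ y))

/-- The metric in a chart. -/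
def chartMetric (x₀ : M) (y : E) : E →L[ℝ] E →L[ℝ] ℝ :=
  (S.metricAt ((extChartAt 𝓘(ℝ, E) x₀).symm y)).bilinearComp (chartInvDeriv x₀ y)
    (chartInvDeriv x₀ y)

theorem symmL_trivializationAt_eq {x₀ x : M} (hx : x ∈ (chartAt E x₀).source) :
    ((trivializationAt E (TangentSpace 𝓘(ℝ, E)) x₀).symmL ℝ x : E →L[ℝ] E) =
      chartInvDeriv x₀ (extChartAt 𝓘(ℝ, E) x₀ x) := by
  have : IsManifold 𝓘(ℝ, E) 1 M := IsManifold.of_le (n := ∞) (by simp)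
  have h := TangentBundle.symmL_trivializationAt (I := 𝓘(ℝ, E)) hx
  rw [ModelWithCorners.range_eq_univ, mfderivWithin_univ] at h
  exact h

/-- Smoothness of a bundle section is smoothness of its coordinates in the trivialization at `x₀`.
Composing with the inverse chart turns this into regularity on the model space; order two suffices
because `Ω` is differentiated twice. -/
theorem contDiffAt_of_comp_chart {F : Type*} [NormedAddCommGroup F] [NormedSpace ℝ F] (x₀ : M)
    {f : M → F} {f' : E → F} (hf : ContMDiffAt 𝓘(ℝ, E) 𝓘(ℝ, F) ∞ f x₀)
    (h : ∀ x ∈ (chartAt E x₀).source, f x = f' (extChartAt 𝓘(ℝ, E) x₀ x)) :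
    ContDiffAt ℝ 2 f' (extChartAt 𝓘(ℝ, E) x₀ x₀) := by
  have h1 : ContMDiffAt 𝓘(ℝ, E) 𝓘(ℝ, E) ∞ (extChartAt 𝓘(ℝ, E) x₀).symm
      (extChartAt 𝓘(ℝ, E) x₀ x₀) :=
    (contMDiffOn_extChartAt_symm (n := ∞) x₀).contMDiffAt
      (target_mem_nhds (mem_extChartAt_target x₀))
  have h2 : ContMDiffAt 𝓘(ℝ, E) 𝓘(ℝ, F) ∞ f
      ((extChartAt 𝓘(ℝ, E) x₀).symm (extChartAt 𝓘(ℝ, E) x₀ x₀)) := by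
    rwa [extChartAt_to_inv]
  have h3 := (ContMDiffAt.comp _ h2 h1).contDiffAt.of_le two_le_infty
  refine h3.congr_of_eventuallyEq ?_
  filter_upwards [target_mem_nhds (mem_extChartAt_target x₀)] with y hy
  have hs := (extChartAt 𝓘(ℝ, E) x₀).map_target hy
  rw [extChartAt_source] at hs
  rw [Function.comp_apply, h _ hs, (extChartAt 𝓘(ℝ, E) x₀).right_inv hy]

theorem contDiffAt_chartJ (x₀ : M) :
    ContDiffAt ℝ 2 (S.chartJ x₀) (extChartAt 𝓘(ℝ, E) x₀ x₀) := by
  have hM1 : IsManifold 𝓘(ℝ, E) 1 M := IsManifold.of_le (n := ∞) (by simp)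
  have h := ((contMDiffAt_hom_bundle _).1 (S.contMDiff_J x₀)).2
  refine contDiffAt_of_comp_chart x₀ h fun x hx => ?_
  have h1 := TangentBundle.continuousLinearMapAt_trivializationAt (I := 𝓘(ℝ, E)) hx
  have h2 := symmL_trivializationAt_eq (E := E) hx
  have h3 : (extChartAt 𝓘(ℝ, E) x₀).symm (extChartAt 𝓘(ℝ, E) x₀ x) = x :=
    (extChartAt 𝓘(ℝ, E) x₀).left_inv (by rwa [extChartAt_source])
  unfold chartJ chartDeriv
  rw [h3, ← h2]
  change ((trivializationAt E (TangentSpace 𝓘(ℝ, E)) x₀).continuousLinearMapAt ℝ x).comp _ = _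
  rw [h1]
  rfl

theorem contDiffAt_chartMetric [FiniteDimensional ℝ E] (x₀ : M) :
    ContDiffAt ℝ 2 (S.chartMetric x₀) (extChartAt 𝓘(ℝ, E) x₀ x₀) := by
  have hM1 : IsManifold 𝓘(ℝ, E) 1 M := IsManifold.of_le (n := ∞) (by simp)
  have h := ((contMDiffAt_hom_bundle _).1 (S.g.contMDiff x₀)).2
  refine contDiffAt_of_comp_chart x₀ h fun x hx => ?_
  have h2 := symmL_trivializationAt_eq (E := E) hx
  have h3 : (extChartAt 𝓘(ℝ, E) x₀).symm (extChartAt 𝓘(ℝ, E) x₀ x) = x :=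
    (extChartAt 𝓘(ℝ, E) x₀).left_inv (by rwa [extChartAt_source])
  ext u v
  have h4 := inCoordinates_apply_eq₂ (𝕜 := ℝ) (F₁ := E) (F₂ := E) (F₃ := ℝ)
    (E₁ := fun x : M => TangentSpace 𝓘(ℝ, E) x) (E₂ := fun x : M => TangentSpace 𝓘(ℝ, E) x)
    (E₃ := Bundle.Trivial M ℝ) (x₀ := x₀) (x := x) (ϕ := S.g.inner x) (v := u) (w := v)
    (by simpa using hx) (by simpa using hx) (Set.mem_univ _)
  refine h4.trans ?_
  unfold chartMetric
  rw [h3, ← h2]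
  have h5 : ∀ w, (trivializationAt E (TangentSpace 𝓘(ℝ, E)) x₀).symmL ℝ x w =
      (trivializationAt E (TangentSpace 𝓘(ℝ, E)) x₀).symm x w := fun w =>
    Bundle.Trivialization.symmL_apply _ (by simpa using hx) w
  change _ = S.g.inner x ((trivializationAt E (TangentSpace 𝓘(ℝ, E)) x₀).symmL ℝ x u)
    ((trivializationAt E (TangentSpace 𝓘(ℝ, E)) x₀).symmL ℝ x v)
  rw [h5, h5]
  simp

/-- Exhibits the chart expression of `Ω` as a fixed continuous linear image of the metric composed
with `J`, so that it inherits their regularity. -/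
theorem inChart_fundamentalForm (x₀ : M) {y : E} (hy : y ∈ (extChartAt 𝓘(ℝ, E) x₀).target) :
    inChart S.fundamentalForm x₀ y =
      alternatizeBilin ((S.chartMetric x₀ y).comp (S.chartJ x₀ y)) := by
  set m := (extChartAt 𝓘(ℝ, E) x₀).symm y with hm
  have key : ∀ u v, (S.chartMetric x₀ y).comp (S.chartJ x₀ y) u v =
      S.formAt m ![chartInvDeriv x₀ y u, chartInvDeriv x₀ y v] := by
    intro u v
    rw [formAt_apply_pair]
    change S.metricAt m (chartInvDeriv x₀ y (chartDeriv x₀ y (S.JAt m (chartInvDeriv x₀ y u))))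
      (chartInvDeriv x₀ y v) = _
    rw [chartInvDeriv_chartDeriv x₀ hy]
  ext v
  rw [alternatizeBilin_apply, key, key, twoForm_swap _ (chartInvDeriv x₀ y (v 1)), inChart_apply]
  change S.formAt m _ = _
  have : (chartInvDeriv x₀ y ∘ v) = ![chartInvDeriv x₀ y (v 0), chartInvDeriv x₀ y (v 1)] := by
    ext k
    fin_cases k <;> rfl
  rw [this]
  ring

theorem contDiffAt_inChart_fundamentalForm [FiniteDimensional ℝ E] (x₀ : M) :
    ContDiffAt ℝ 2 (inChart S.fundamentalForm x₀) (extChartAt 𝓘(ℝ, E) x₀ x₀) := by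
  have h0 : ContDiffAt ℝ 2 (fun y => (S.chartMetric x₀ y).comp (S.chartJ x₀ y))
      (extChartAt 𝓘(ℝ, E) x₀ x₀) :=
    (S.contDiffAt_chartMetric x₀).clm_comp (S.contDiffAt_chartJ x₀)
  have h1 := contDiffAt_alternatizeBilin h0
  refine h1.congr_of_eventuallyEq ?_
  filter_upwards [target_mem_nhds (mem_extChartAt_target x₀)] with y hy
  exact S.inChart_fundamentalForm x₀ hy

end HermitianStructure

end HermitianCharts

/-! ### From balanced and `□Ω = 0` to Kähler. -/

section BalancedPluriclosed

variable {E : Type*} [NormedAddCommGroup E] [NormedSpace ℝ E]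
  {ι : Type*} [Fintype ι] [DecidableEq ι]

theorem contractInv_map (Ω Ω' : E [⋀^Fin 2]→L[ℝ] ℝ) (b : Module.Basis ι ℝ E) (L : E ≃ₗ[ℝ] E)
    (h : ∀ u v, Ω' ![u, v] = Ω ![L u, L v]) (β : E → E → ℝ) :
    contractInv Ω' b (fun u v => β (L u) (L v)) = contractInv Ω (b.map L) β := by
  have : formMatrix Ω' b = formMatrix Ω (b.map L) := by
    ext i j
    simp [formMatrix_apply, h]
  simp [contractInv, this]

theorem contractInv_insertFirst_independent {l m : ℕ} (hlm : 2 + l = m) (Ω : E [⋀^Fin 2]→L[ℝ] ℝ)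
    (b c : Module.Basis ι ℝ E) (φ : E [⋀^Fin m]→L[ℝ] ℝ) (w : Fin l → E) :
    contractInv Ω b (fun u v => insertFirst hlm φ ![u, v] w) =
      contractInv Ω c (fun u v => insertFirst hlm φ ![u, v] w) := by
  set ψ := castForm (show m = l + 1 + 1 by omega) φ
  let β : LinearMap.BilinForm ℝ E := LinearMap.mk₂ ℝ (fun u v => (ψ.curryLeft u).curryLeft v w)
    (fun u u' v => by simp) (fun c u v => by simp) (fun u v v' => by simp) (fun c u v => by simp)
  have hβ : ∀ u v, insertFirst hlm φ ![u, v] w = β u v := fun u v =>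
    insertFirst_two_apply hlm φ u v w
  simp only [hβ]
  exact contractInv_basis_independent Ω b c β

theorem contractInv_threeForm_independent (Ω : E [⋀^Fin 2]→L[ℝ] ℝ) (T : E [⋀^Fin 3]→L[ℝ] ℝ)
    (b c : Module.Basis ι ℝ E) (v : E) :
    contractInv Ω b (fun u u' => T ![v, u, u']) = contractInv Ω c (fun u u' => T ![v, u, u']) :=
  contractInv_basis_independent Ω b c (twoFormBilin (T.curryLeft v))

variable {M : Type*} [TopologicalSpace M] [ChartedSpace E M] [IsManifold 𝓘(ℝ, E) ∞ M]

/-- The derivative of the inverse of a chart, as a linear equivalence. -/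
def chartInvEquiv (x₀ : M) {y : E} (hy : y ∈ (extChartAt 𝓘(ℝ, E) x₀).target) : E ≃ₗ[ℝ] E where
  toLinearMap := (chartInvDeriv x₀ y : E →ₗ[ℝ] E)
  invFun := chartDeriv x₀ y
  left_inv := chartDeriv_chartInvDeriv x₀ hy
  right_inv := chartInvDeriv_chartDeriv x₀ hy

namespace HermitianStructure

variable (S : HermitianStructure E M)

/-- The complex structure at a point, as a linear equivalence. -/
def JEquiv (x : M) : E ≃ₗ[ℝ] E where
  toLinearMap := (S.JAt x : E →ₗ[ℝ] E)
  invFun v := -S.JAt x v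
  left_inv v := by
    change -S.JAt x (S.JAt x v) = v
    rw [S.JAt_JAt, neg_neg]
  right_inv v := by
    change S.JAt x (-S.JAt x v) = v
    rw [map_neg, S.JAt_JAt, neg_neg]

/-- The exterior derivative of the fundamental form, at a point. -/
def torsionAt (x : M) : E [⋀^Fin 3]→L[ℝ] ℝ := exteriorD S.fundamentalForm x

theorem isUnit_det_formMatrix_formAt (x : M) (b : Module.Basis ι ℝ E) :
    IsUnit (formMatrix (S.formAt x) b).det :=
  isUnit_det_formMatrix (S.metricAt_pos x) (S.JAt_JAt x) _ (S.formAt_apply_pair x) b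

variable [FiniteDimensional ℝ E]

theorem wedgePower_formAt_ne_zero {n : ℕ} (hn : 0 < n) (hdim : Module.finrank ℝ E = 2 * n)
    (x : M) : wedgePower n (S.formAt x) ≠ 0 :=
  wedgePower_fundamental_ne_zero hn hdim (S.metricAt_symm x) (S.metricAt_pos x) (S.JAt_JAt x)
    (S.metricAt_J_J x) _ (S.formAt_apply_pair x)

theorem differentiableAt_inChart_fundamentalForm (x₀ : M) :
    DifferentiableAt ℝ (inChart S.fundamentalForm x₀) (extChartAt 𝓘(ℝ, E) x₀ x₀) :=
  (S.contDiffAt_inChart_fundamentalForm x₀).differentiableAt two_ne_zero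

/-- By `hodgeStar_fundamental` the star of `Ω` is built from `Ω` alone. It therefore commutes with
pullback by the chart, up to a change of basis that does not affect the trace. -/
theorem inChart_hodge_fundamentalForm {n l : ℕ} (h : 2 + l = 2 * n) (x₀ : M) {y : E}
    (hy : y ∈ (extChartAt 𝓘(ℝ, E) x₀).target) (w : Fin l → E) :
    inChart (S.hodge h S.fundamentalForm) x₀ y w = -(1 / 2) *
      contractInv (inChart S.fundamentalForm x₀ y) (Module.finBasis ℝ E) (fun u v =>
        insertFirst h (((n.factorial : ℝ)⁻¹) • wedgePower n (inChart S.fundamentalForm x₀ y))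
          ![u, v] w) := by
  set m := (extChartAt 𝓘(ℝ, E) x₀).symm y
  have h1 : inChart (S.hodge h S.fundamentalForm) x₀ y w =
      hodgeStar h (S.metricAt m) (((n.factorial : ℝ)⁻¹) • wedgePower n (S.formAt m))
        (Module.finBasis ℝ E) (S.formAt m) (chartInvDeriv x₀ y ∘ w) := rfl
  rw [h1, hodgeStar_fundamental (S.metricAt_symm m) (S.metricAt_pos m) (S.JAt_JAt m) (S.formAt m)
    (S.formAt_apply_pair m)]
  congr 1
  have hω : inChart S.fundamentalForm x₀ y =
      (S.formAt m).compContinuousLinearMap (chartInvDeriv x₀ y) := rfl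
  have h2 : ∀ u v, insertFirst h (((n.factorial : ℝ)⁻¹) •
      wedgePower n (inChart S.fundamentalForm x₀ y)) ![u, v] w =
      insertFirst h (((n.factorial : ℝ)⁻¹) • wedgePower n (S.formAt m))
        ![chartInvEquiv x₀ hy u, chartInvEquiv x₀ hy v] (chartInvDeriv x₀ y ∘ w) := by
    intro u v
    rw [hω, wedgePower_compContinuousLinearMap, insertFirst_two_apply, insertFirst_two_apply,
      castForm_apply, castForm_apply]
    simp only [ContinuousAlternatingMap.smul_apply,
      ContinuousAlternatingMap.compContinuousLinearMap_apply]
    congr 2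
    funext i
    simp only [Function.comp_apply]
    refine Fin.cases ?_ (fun i => ?_) (Fin.cast _ i)
    · rfl
    · refine Fin.cases ?_ (fun i => ?_) i <;> rfl
  simp only [h2]
  rw [contractInv_map (S.formAt m) _ _ (chartInvEquiv x₀ hy) (fun u v => ?_)
    (fun u v => insertFirst h (((n.factorial : ℝ)⁻¹) • wedgePower n (S.formAt m)) ![u, v]
      (chartInvDeriv x₀ y ∘ w))]
  · exact contractInv_insertFirst_independent h _ _ _ _ _
  · rw [hω, ContinuousAlternatingMap.compContinuousLinearMap_apply]
    congr 1
    ext k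
    fin_cases k <;> rfl

/-- On a balanced manifold, the exterior derivative of the fundamental form is trace-free. -/
theorem contractInv_torsionAt_eq_zero {n : ℕ} (hn : 1 ≤ n) (hdim : Module.finrank ℝ E = 2 * n)
    {x : M} (hlee : S.leeForm hn x = 0) (v : E) :
    contractInv (S.formAt x) (Module.finBasis ℝ E) (fun u u' => S.torsionAt x ![v, u, u']) = 0 := by
  set p := extChartAt 𝓘(ℝ, E) x x
  have h2 : 2 + (2 * n - 2) = 2 * n := by omega
  have h1 : (2 * n - 2 + 1) + 1 = 2 * n := by omega
  have hp : inChart S.fundamentalForm x p = S.formAt x := inChart_center _ x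
  have hT : S.torsionAt x = extDeriv (inChart S.fundamentalForm x) p := exteriorD_eq_extDeriv _ x
  obtain ⟨D, hD1, hD2⟩ := exists_extDeriv_star hdim h2 (Module.finBasis ℝ E)
    (S.differentiableAt_inChart_fundamentalForm x)
    (by rw [hp]; exact S.isUnit_det_formMatrix_formAt x _)
    (by rw [hp]; exact S.wedgePower_formAt_ne_zero hn hdim x)
    ((n.factorial : ℝ)⁻¹) (α := inChart (S.hodge h2 S.fundamentalForm) x) (by
      filter_upwards [target_mem_nhds (mem_extChartAt_target x)] with y hy w
      exact S.inChart_hodge_fundamentalForm h2 x hy w)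
  rw [hp] at hD1 hD2
  rw [hT]
  refine hD2 ?_ v
  set β : E [⋀^Fin (2 * n - 2 + 1)]→L[ℝ] ℝ := exteriorD (S.hodge h2 S.fundamentalForm) x with hβdef
  have hβ : β = extDeriv (inChart (S.hodge h2 S.fundamentalForm) x) p := exteriorD_eq_extDeriv _ x
  have hstar : hodgeStar h1 (S.metricAt x) (((n.factorial : ℝ)⁻¹) • wedgePower n (S.formAt x))
      (Module.finBasis ℝ E) β = 0 := by
    ext w
    have h3 : S.leeForm hn x = (hodgeStar h1 (S.metricAt x)
      (((n.factorial : ℝ)⁻¹) • wedgePower n (S.formAt x)) (Module.finBasis ℝ E)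
        β).compContinuousLinearMap (S.JAt x) := rfl
    rw [h3] at hlee
    -- The outer `J` of the Lee form is invertible; evaluating at `-J w` removes it.
    have h4 := congrArg (fun F : E [⋀^Fin 1]→L[ℝ] ℝ => F (fun i => -S.JAt x (w i))) hlee
    have h5 : (S.JAt x ∘ fun i => -S.JAt x (w i)) = w := by
      funext i
      simp [S.JAt_JAt]
    change hodgeStar h1 _ _ _ β (S.JAt x ∘ fun i => -S.JAt x (w i)) = 0 at h4
    rw [h5] at h4
    exact h4
  refine eq_zero_of_hodgeStar_contract_eq_zero (S.metricAt_pos x) (Module.finBasis ℝ E) h1 hdim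
    (smul_ne_zero (by positivity) (S.wedgePower_formAt_ne_zero hn hdim x)) β D ?_ hstar
  intro w
  rw [hβ]
  exact hD1 w

/-- A balanced Hermitian manifold with `□Ω = 0` is Kähler. -/
theorem exteriorD_eq_zero_of_balanced_of_box {n : ℕ} (hn : 1 ≤ n)
    (hdim : Module.finrank ℝ E = 2 * n) (hbal : S.IsBalanced hn)
    (hbox : S.box S.fundamentalForm = 0) : exteriorD S.fundamentalForm = 0 := by
  funext x
  set p := extChartAt 𝓘(ℝ, E) x x
  set η := inChart S.fundamentalForm x
  set T : DiffForm E M 3 := exteriorD S.fundamentalForm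
  have hηC : ContDiffAt ℝ 2 η p := S.contDiffAt_inChart_fundamentalForm x
  have hη : DifferentiableAt ℝ η p := S.differentiableAt_inChart_fundamentalForm x
  have hp : η p = S.formAt x := inChart_center _ x
  have htarget := target_mem_nhds (E := E) (mem_extChartAt_target (I := 𝓘(ℝ, E)) x)
  set σ := inChart (S.actJ T) x
  have hσ_apply : ∀ y v, σ y v = S.torsionAt ((extChartAt 𝓘(ℝ, E) x).symm y)
      (S.JAt ((extChartAt 𝓘(ℝ, E) x).symm y) ∘ chartInvDeriv x y ∘ v) := fun y v => rfl
  have hσ : σ =ᶠ[𝓝 p] fun y => (extDeriv η y).compContinuousLinearMap (S.chartJ x y) := by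
    filter_upwards [htarget] with y hy
    ext v
    rw [← inChart_exteriorD S.fundamentalForm x hy S.differentiableAt_inChart_fundamentalForm,
      ContinuousAlternatingMap.compContinuousLinearMap_apply, hσ_apply]
    change _ = S.torsionAt ((extChartAt 𝓘(ℝ, E) x).symm y)
      (chartInvDeriv x y ∘ S.chartJ x y ∘ v)
    congr 1
    funext i
    exact (chartInvDeriv_chartDeriv x hy _).symm
  have hσd : DifferentiableAt ℝ σ p := by
    have h1 : DifferentiableAt ℝ (fderiv ℝ η) p :=
      (hηC.fderiv_right (m := 1) (by norm_num)).differentiableAt one_ne_zero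
    have h2 : DifferentiableAt ℝ (extDeriv η) p :=
      (ContinuousAlternatingMap.alternatizeUncurryFinCLM ℝ E ℝ).differentiableAt.comp p h1
    have h3 : DifferentiableAt ℝ (S.chartJ x) p :=
      (S.contDiffAt_chartJ x).differentiableAt two_ne_zero
    exact (h2.continuousAlternatingMapCompContinuousLinearMap h3).congr_of_eventuallyEq hσ
  have hcl : extDeriv σ p = 0 := by
    have h1 : exteriorD (S.actJ T) x = extDeriv σ p := exteriorD_eq_extDeriv _ x
    rw [← h1]
    ext v
    have h2 := congrArg (fun F : E [⋀^Fin 4]→L[ℝ] ℂ => F v) (congrFun hbox x)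
    change (Complex.I / 2) * ((exteriorD (S.actJ T) x v : ℝ) : ℂ) = 0 at h2
    have h3 := (mul_eq_zero.1 h2).resolve_left (by simp)
    exact_mod_cast h3
  obtain ⟨b₀, hb₀, -⟩ := exists_unitary_basis hn hdim (S.metricAt_symm x) (S.metricAt_pos x)
    (S.JAt_JAt x) (S.metricAt_J_J x)
  -- Basis independence of the trace compares bases with the same index type, hence the reindexing
  -- to that of `Module.finBasis`. The basis is orthonormal only for the metric at `x`; in the chart
  -- it is kept constant.
  let ε : Fin n × Fin 2 ≃ Fin (Module.finrank ℝ E) :=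
    Fintype.equivOfCardEq (by simp [hdim, mul_comm])
  have hb : ∀ i j, S.metricAt x ((b₀.reindex ε) i) ((b₀.reindex ε) j) =
      if i = j then 1 else 0 := by
    intro i j
    simp [hb₀]
  have htr : ∀ᶠ y in 𝓝 p, ∀ v,
      contractInv (η y) (b₀.reindex ε) (fun u u' => σ y ![v, u, u']) = 0 := by
    filter_upwards [htarget] with y hy v
    set m := (extChartAt 𝓘(ℝ, E) x).symm y
    -- `L` is the inverse chart derivative followed by `J`. It pulls the torsion at `m` back to `σ
    -- y`, and pulls `Ω` back to `η y` because `J` preserves `Ω`, so the trace of `σ y` is that of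
    -- the torsion at `m`.
    let L := (chartInvEquiv x hy).trans (S.JEquiv m)
    have h1 : ∀ u u', σ y ![v, u, u'] = S.torsionAt m ![L v, L u, L u'] := by
      intro u u'
      rw [hσ_apply]
      congr 1
      ext k
      fin_cases k <;> rfl
    simp only [h1]
    rw [contractInv_map (S.formAt m) _ _ L (fun u u' => ?_)
      (fun u u' => S.torsionAt m ![L v, u, u']),
      contractInv_threeForm_independent _ _ _ (Module.finBasis ℝ E)]
    · exact S.contractInv_torsionAt_eq_zero hn hdim (congrFun hbal m) (L v)
    · change _ = S.formAt m ![S.JAt m (chartInvDeriv x y u), S.JAt m (chartInvDeriv x y u')]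
      rw [S.formAt_J_J]
      change S.formAt m (chartInvDeriv x y ∘ ![u, u']) = _
      congr 1
      ext k
      fin_cases k <;> rfl
  have hσp : ∀ u v w, σ p ![u, v, w] = extDeriv η p ![S.JAt x u, S.JAt x v, S.JAt x w] := by
    intro u v w
    have h1 : σ p = S.actJ T x := inChart_center _ x
    have h2 : S.torsionAt x = extDeriv η p := exteriorD_eq_extDeriv _ x
    rw [h1, ← h2]
    change S.torsionAt x _ = _
    congr 1
    ext k
    fin_cases k <;> rfl
  have hfin := extDeriv_eq_zero_of_twist_closed hη hσd (S.JAt_JAt x)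
    (fun u v => by rw [hp]; exact S.formAt_apply_pair x u v) (b₀.reindex ε) hb htr hcl hσp
  exact (exteriorD_eq_extDeriv S.fundamentalForm x).trans hfin

end HermitianStructure

end BalancedPluriclosed

end

theorem mainTheorem5
    {E : Type*} [NormedAddCommGroup E] [NormedSpace ℝ E] [FiniteDimensional ℝ E]
    {M : Type*} [TopologicalSpace M] [ChartedSpace E M] [IsManifold 𝓘(ℝ, E) ∞ M]
    (n : ℕ) (hn : 3 ≤ n) (hdim : Module.finrank ℝ E = 2 * n)
    (S : HermitianStructure E M) :
    (S.IsSKT → S.leeForm (n := n) (by omega) ≠ 0) ∧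
      (S.IsBalanced (n := n) (by omega) → S.box S.fundamentalForm = 0 → S.IsKahler) :=
  have hn1 : 1 ≤ n := by omega
  ⟨fun hskt hlee => hskt.2 (S.exteriorD_eq_zero_of_balanced_of_box hn1 hdim hlee hskt.1),
    fun hbal hbox => S.exteriorD_eq_zero_of_balanced_of_box hn1 hdim hbal hbox⟩
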